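/- **Proposition 4.2 (RSK in modules).** Let $\mathfrak o$ be a complete discrete valuation ring with maximal ideal $\mathfrak p$, uniformizer $\pi$ and finite residue field $\mathfrak k=\mathfrak o/\mathfrak p$. Put $\mathfrak o_1=\mathfrak k$, $\mathfrak o_2=\mathfrak o/\mathfrak p^2$ and $G=\mathrm{GL}_n(\mathfrak o_2)$. A module isomorphic to $\mathfrak o_2^a\oplus\mathfrak o_1^b$ is said to have type $(2^a1^b)$ and rank $a+b$. Fix a type $\lambda=(2^A1^B)$ and assume $n\ge 2(A+B)$ and $A+B\ge 2A$. A *flag* is a pair $x=(x_2,x_1)$ of submodules $\mathfrak o_2^n\supseteq x_2\supseteq x_1$. Write $y\le x$ if there are injective homomorphisms $y_2\to x_2$ and $y_1\to x_1$ compatible with the inclusions, and $y\sim x$ if such maps can be chosen to be isomorphisms. For a submodule $y$ put $\iota(y)=(y,\pi y)$. Let $\mathcal S_\lambda$ be the set of flags $x=(x_2,x_1)$ with (1) $\pi x_2\subseteq x_1$; (2) $x\le\iota(y)$ for some submodule $y\subseteq\mathfrak o_2^n$ of type $\lambda$; (3) $\mathrm{Rank}(x_1)\le\mathrm{Rank}(x_2/x_1)$.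 Let $\mathcal P_\lambda=\mathcal S_\lambda/\!\sim$ with the induced relation $\le$, and for $\xi\in\mathcal P_\lambda$ let $Y_\xi\subseteq\mathcal S_\lambda$ be the set of flags of class $\xi$. Denote by $\iota(\lambda)\in\mathcal P_\lambda$ the class of the flags $(x_2,\pi x_2)$ with $x_2$ of type $\lambda$. Write $Y_\eta\times_GY_\xi$ for the set of $G$-orbits on $Y_\eta\times Y_\xi$ under the diagonal action. For $x\in\mathcal S_\lambda$ let $x_\pi$ be the flag of $\mathfrak k$-vector spaces $\mathfrak k^n\supseteq x_2[\pi]\supseteq x_1\supseteq\pi x_2\supseteq 0$, where $\mathfrak k^n$ is identified with $\mathfrak o_2^n[\pi]$ and $[\pi]$ denotes the kernel of multiplication by $\pi$. For two decreasing flags $F_0\supseteq F_1\supseteq\cdots$ and $E_0\supseteq E_1\supseteq\cdots$ of the same finite-dimensional $\mathfrak k$-vector space $F_0=E_0$ that end in $0$, put $$a_{ij}=\dim_{\mathfrak k}\frac{F_i\cap E_j}{F_i\cap E_{j+1}+F_{i+1}\cap E_j},$$ and say that $F$ is in *semistandard position* to $E$ if the tableau whose $i$-th row consists of $a_{ij}$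 entries $j$ for each $j$, in weakly increasing order, is a semistandard Young tableau (its row lengths form a partition and its columns are strictly increasing). For $y,x\in\mathcal S_\lambda$, say that $y$ *embeds permissibly* into $x$ if $y_2\subseteq x_2$, $y_1\subseteq x_1$, and the flag $y_\pi/\pi y_2$ is in semistandard position to the flag $x_\pi/\pi y_2$ in $\mathfrak k^n/\pi y_2$. Let $(Y_\eta\times_GY_\xi)^\circ\subseteq Y_\eta\times_GY_\xi$ be the set of orbits of pairs $(y,x)$ such that $y$ embeds permissibly into $x$. Then for every $\xi\in\mathcal P_\lambda$ there is a bijection $$Y_{\iota(\lambda)}\times_GY_\xi\;\longleftrightarrow\;\bigsqcup_{\eta\in\mathcal P_\lambda,\ \eta\le\xi}(Y_\eta\times_GY_{\iota(\lambda)})^\circ\times(Y_\eta\times_GY_\xi)^\circ .$$ -/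

import Mathlib

/-! Throughout, `R` plays the role of `𝔬₂ = 𝔬 / 𝔭²`, the element `π : R` is the image of a
uniformizer, and `R ⧸ (π)` is the residue field `𝔬₁ = 𝔨` seen as an `R`-module. -/

namespace RSKModules

section Modules

variable {R : Type*} [CommRing R] (π : R)

/-- `M` is of type `(2^a 1^b)`, i.e. `M ≅ 𝔬₂^a ⊕ 𝔬₁^b`. -/
def HasType (M : Type*) [AddCommGroup M] [Module R M] (a b : ℕ) : Prop :=
  Nonempty (M ≃ₗ[R] (Fin a → R) × (Fin b → R ⧸ Ideal.span {π}))

/-- `M` has rank `r`: the partition associated with `M` has length `r`. -/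
def HasRank (M : Type*) [AddCommGroup M] [Module R M] (r : ℕ) : Prop :=
  ∃ a b : ℕ, a + b = r ∧ HasType π M a b

/-- The image `πx` of the submodule `x` under multiplication by `π`. -/
def piMul {M : Type*} [AddCommGroup M] [Module R M] (x : Submodule R M) : Submodule R M :=
  x.map (LinearMap.lsmul R M π)

/-- The kernel `x[π]` of multiplication by `π` on the submodule `x`. -/
def piTorsion {M : Type*} [AddCommGroup M] [Module R M] (x : Submodule R M) : Submodule R M :=
  x ⊓ LinearMap.ker (LinearMap.lsmul R M π)

theorem piMul_le {M : Type*} [AddCommGroup M] [Module R M] (x : Submodule R M) :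
    piMul π x ≤ x := by
  rintro _ ⟨v, hv, rfl⟩
  exact x.smul_mem π hv

end Modules

section Permissible

variable {R : Type*} [CommRing R] {M : Type*} [AddCommGroup M] [Module R M]

/-- The `(i, j)` entry (counted from `0`) of the intersection matrix of two decreasing flags
`F 0 ⊇ F 1 ⊇ ⋯` and `G 0 ⊇ G 1 ⊇ ⋯`: the dimension of
`(F i ∩ G j) / (F i ∩ G (j+1) + F (i+1) ∩ G j)`. It is used for flags of modules killed by `π`,
for which the length over `R` is the dimension over the residue field. -/
noncomputable def intersectionMatrix (F G : ℕ → Submodule R M) (i j : ℕ) : ℕ∞ :=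
  Module.length R (↥(F i ⊓ G j) ⧸ (F i ⊓ G (j + 1) ⊔ F (i + 1) ⊓ G j).submoduleOf (F i ⊓ G j))

/-- The tableau attached to the intersection matrix `(a i j)` of `F` and `G`, with `a i j` many
entries `j` in its `i`-th row (weakly increasing along rows), is a semistandard Young tableau.
Row `i` has `∑ j, a i j = dim (F i / F (i+1))` boxes, and the letter `j` occurs
`∑ i, a i j = dim (G j / G (j+1))` times. Zero steps of `F` or `G` only give empty rows or
unused letters. -/
def IsSemistandardPosition (F G : ℕ → Submodule R M) : Prop :=
  ∃ (μ : YoungDiagram) (T : SemistandardYoungTableau μ), ∀ i j : ℕ,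
    ((((Finset.range (μ.rowLen i)).filter fun p => T i p = j).card : ℕ) : ℕ∞) =
      intersectionMatrix F G i j

end Permissible

section Flags

variable {R : Type*} [CommRing R] {n : ℕ}

/-- The space `𝓛⁽²⁾` of flags `R^n ⊇ x₂ ⊇ x₁` of submodules. -/
@[ext]
structure TwoFlag (R : Type*) [CommRing R] (n : ℕ) where
  /-- the larger module `x₂` -/
  top : Submodule R (Fin n → R)
  /-- the smaller module `x₁` -/
  bot : Submodule R (Fin n → R)
  bot_le_top : bot ≤ top

/-- `GL_n(R)` acts on flags by taking images. -/
instance : MulAction (Matrix.GeneralLinearGroup (Fin n) R) (TwoFlag R n) where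
  smul g x :=
    { top := x.top.map (Matrix.mulVecLin (g : Matrix (Fin n) (Fin n) R))
      bot := x.bot.map (Matrix.mulVecLin (g : Matrix (Fin n) (Fin n) R))
      bot_le_top := Submodule.map_mono x.bot_le_top }
  one_smul x := by
    apply TwoFlag.ext
    · change x.top.map (Matrix.mulVecLin (1 : Matrix (Fin n) (Fin n) R)) = x.top
      rw [Matrix.mulVecLin_one, Submodule.map_id]
    · change x.bot.map (Matrix.mulVecLin (1 : Matrix (Fin n) (Fin n) R)) = x.bot
      rw [Matrix.mulVecLin_one, Submodule.map_id]
  mul_smul g h x := by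
    apply TwoFlag.ext
    · change x.top.map (Matrix.mulVecLin
        ((g : Matrix (Fin n) (Fin n) R) * (h : Matrix (Fin n) (Fin n) R))) =
        (x.top.map (Matrix.mulVecLin (h : Matrix (Fin n) (Fin n) R))).map
          (Matrix.mulVecLin (g : Matrix (Fin n) (Fin n) R))
      rw [Matrix.mulVecLin_mul, Submodule.map_comp]
    · change x.bot.map (Matrix.mulVecLin
        ((g : Matrix (Fin n) (Fin n) R) * (h : Matrix (Fin n) (Fin n) R))) =
        (x.bot.map (Matrix.mulVecLin (h : Matrix (Fin n) (Fin n) R))).map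
          (Matrix.mulVecLin (g : Matrix (Fin n) (Fin n) R))
      rw [Matrix.mulVecLin_mul, Submodule.map_comp]

/-- The relation `y ≤ x` on flags: there are embeddings `y₂ → x₂` and `y₁ → x₁`
compatible with the inclusions. -/
def FlagLE (y x : TwoFlag R n) : Prop :=
  ∃ (φ₂ : y.top →ₗ[R] x.top) (φ₁ : y.bot →ₗ[R] x.bot),
    Function.Injective φ₂ ∧ Function.Injective φ₁ ∧
      ∀ v : y.bot, φ₂ (Submodule.inclusion y.bot_le_top v) =
        Submodule.inclusion x.bot_le_top (φ₁ v)

/-- Equivalence `y ∼ x` of flags: the vertical maps are isomorphisms. -/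
def FlagEquiv (y x : TwoFlag R n) : Prop :=
  ∃ (φ₂ : y.top ≃ₗ[R] x.top) (φ₁ : y.bot ≃ₗ[R] x.bot),
    ∀ v : y.bot, φ₂ (Submodule.inclusion y.bot_le_top v) =
      Submodule.inclusion x.bot_le_top (φ₁ v)

theorem flagEquiv_equivalence : Equivalence (FlagEquiv (R := R) (n := n)) where
  refl _ := ⟨LinearEquiv.refl R _, LinearEquiv.refl R _, fun _ => rfl⟩
  symm := by
    rintro x y ⟨φ₂, φ₁, h⟩
    refine ⟨φ₂.symm, φ₁.symm, fun v => ?_⟩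
    rw [LinearEquiv.symm_apply_eq, h, LinearEquiv.apply_symm_apply]
  trans := by
    rintro x y z ⟨φ₂, φ₁, h⟩ ⟨ψ₂, ψ₁, k⟩
    refine ⟨φ₂.trans ψ₂, φ₁.trans ψ₁, fun v => ?_⟩
    rw [LinearEquiv.trans_apply, LinearEquiv.trans_apply, h, k]

variable (π : R)

/-- The flag `ι(y) = (y, πy)`. -/
def iota (y : Submodule R (Fin n → R)) : TwoFlag R n :=
  ⟨y, piMul π y, piMul_le π y⟩

/-- The set `𝓢_λ` for `λ = (2^A 1^B)`: the flags `(x₂, x₁)` in `R^n` such that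
* `πx₂ ⊆ x₁` (among such submodules `x₁` killed by `π`, the type of `x₁` determines `x₁` up to an
  automorphism of `x₂`);
* `(x₂, x₁) ≤ ι(y)` for a submodule `y` of type `λ`;
* `Rank x₁ ≤ Rank (x₂ / x₁)`. -/
def IsParamFlag (A B : ℕ) (x : TwoFlag R n) : Prop :=
  piMul π x.top ≤ x.bot ∧
  (∃ y : Submodule R (Fin n → R), HasType π y A B ∧ FlagLE x (iota π y)) ∧
  ∃ r s : ℕ, HasRank π x.bot r ∧ HasRank π (x.top ⧸ x.bot.submoduleOf x.top) s ∧ r ≤ s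

/-- The set `𝓢_λ` as a type. -/
abbrev ParamFlag (n A B : ℕ) : Type _ :=
  {x : TwoFlag R n // IsParamFlag π A B x}

/-- Equivalence of flags on `𝓢_λ`. -/
instance paramSetoid (n A B : ℕ) : Setoid (ParamFlag π n A B) where
  r y x := FlagEquiv y.1 x.1
  iseqv := ⟨fun x => flagEquiv_equivalence.refl x.1, fun h => flagEquiv_equivalence.symm h,
    fun h k => flagEquiv_equivalence.trans h k⟩

/-- The parameter set `𝓟_λ = 𝓢_λ / ∼`. -/
abbrev ParamSet (n A B : ℕ) : Type _ :=
  Quotient (paramSetoid π n A B)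

variable {π} {A B : ℕ}

/-- The order `η ≤ ξ` on `𝓟_λ` inherited from the order on flags. -/
def ParamLE (η ξ : ParamSet π n A B) : Prop :=
  ∃ y x : ParamFlag π n A B, ⟦y⟧ = η ∧ ⟦x⟧ = ξ ∧ FlagLE y.1 x.1

/-- `Y_ξ`, the set of all flags in `𝓢_λ` of class `ξ`. -/
def Y (ξ : ParamSet π n A B) : Set (TwoFlag R n) :=
  {x | ∃ h : IsParamFlag π A B x, (⟦⟨x, h⟩⟧ : ParamSet π n A B) = ξ}

variable (π)

/-- The flag of `π`-torsion points `x_π = (𝔨^n ⊇ x₂[π] ⊇ x₁ ⊇ πx₂ ⊇ 0)`, where `𝔨^n` is the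
`π`-torsion of `R^n`. -/
def torsionFlag (x : TwoFlag R n) : ℕ → Submodule R (Fin n → R)
  | 0 => piTorsion π ⊤
  | 1 => piTorsion π x.top
  | 2 => x.bot
  | 3 => piMul π x.top
  | _ => ⊥

/-- `y` embeds permissibly into `x`: it is contained in `x`, and the flag `y_π / πy₂` is in
permissible (semistandard) position in the flag `x_π / πy₂`. -/
def EmbedsPermissibly (y x : TwoFlag R n) : Prop :=
  y.top ≤ x.top ∧ y.bot ≤ x.bot ∧
    IsSemistandardPosition
      (fun i => (torsionFlag π y i).map (piMul π y.top).mkQ)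
      (fun j => (torsionFlag π x j).map (piMul π y.top).mkQ)

variable {π}

/-- `Y_η ×_G Y_ξ`: the orbits of `G = GL_n(R)` on `Y_η × Y_ξ` (diagonal action). -/
def pairOrbits (η ξ : ParamSet π n A B) : Set (Set (TwoFlag R n × TwoFlag R n)) :=
  {Ω | ∃ y ∈ Y η, ∃ x ∈ Y ξ, Ω = MulAction.orbit (Matrix.GeneralLinearGroup (Fin n) R) (y, x)}

/-- `(Y_η ×_G Y_ξ)°`: the orbits of pairs `(y, x)` such that `y` embeds permissibly into `x`. -/
def permissibleOrbits (η ξ : ParamSet π n A B) : Set (Set (TwoFlag R n × TwoFlag R n)) :=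
  {Ω | ∃ y ∈ Y η, ∃ x ∈ Y ξ, EmbedsPermissibly π y x ∧
    Ω = MulAction.orbit (Matrix.GeneralLinearGroup (Fin n) R) (y, x)}

end Flags

end RSKModules

namespace RSKModules

open Module Submodule

set_option linter.unusedSectionVars false

/-! ### Linear algebra: a common adapted basis for two flags of subspaces. -/

section RelativePosition

variable {K : Type*} [Field K]

/-! The plan is to classify the orbits of pairs of flags by integer data, to recognise
permissibility in these data, and to match the data by the RSK correspondence for matrices with two
rows and three columns.

Classification. Reduction `q : R^n → 𝔨^n` and the identification `j` of `𝔨^n` with the `π`-torsion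
satisfy `j (q m) = π m`. A flag `(y₂, y₁)` thus gives subspaces `𝔨^n ⊇ y₂[π] ⊇ y₁ ⊇ πy₂` of `𝔨^n`.
Two such chains have a common adapted basis, but it need not lift to an `R`-basis adapted to both
flags, because a vector of `πy₂ ∩ πx₂` need not come from `y₂ ∩ x₂`. Adding the reduction of `y₂ ∩
x₂` as a last step to the first chain isolates the obstruction. For each bad basis vector, its lifts
to `y₂` and `x₂` differ by a torsion vector, and these differences are independent modulo `y₂[π] +
x₂[π]` (`linearIndependent_twist`). Hence every pair has a normal form (`exists_twist_adapted`): `t`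
blocks with `b` in `y₂` and `b + πb'` in `x₂`, together with `c i k` basis vectors of label `(i,
k)`, a label being the depth reached in the chain. The sixteen intersection dimensions of the chains
and the dimension `c 3 3` of the reduction of `y₂ ∩ x₂` determine `(t, c)` (`pairPosition_unique`).
So orbits correspond to the data `(t, c)` with prescribed marginals.

Parameters. A class in `𝓟_λ` amounts to the dimensions `(P, S, T)` of `πx₂`, `x₁`, `x₂[π]`, where `P
≤ S ≤ T`, `S ≤ A`, `T ≤ A + B`, and the rank condition says that `(T - S, S - P)` is a partition
(`isParamFlag_iff`). A position is permissible exactly when `t = 0`, row `3` of `c` is concentrated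
in `c 3 3`, and rows `0`, `1`, `2` interlace (`embedsPermissibly_iff`).

Combinatorics. If the first flag is of class `ι(λ)`, row `2` of `c` vanishes, and the marginals
reduce the data to `c 3 3` and the matrix with rows `(c 1 1, c 1 2, c 1 3)` and `(c 3 1, c 3 2, t)`.
On the other side, rows `1` and `2` of the two permissible positions are tableaux of the common
shape `(T - S, S - P)` of `η`, the one for `ι(λ)` using only the letters `1` and `3`. RSK matches
the two sides, with `c 3 3` carried along unchanged. The bound `n ≥ 2(A + B)` makes the leftover
entry `c 0 0` nonnegative and makes row `0` long enough not to constrain row `1`. -/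

theorem exists_mem_iff_le {V : Type*} [AddCommGroup V] [Module K V] (G : ℕ → Submodule K V)
    (hG : Antitone G) (h0 : G 0 = ⊤) {p : ℕ} (hp : G p = ⊥) {v : V} (hv : v ≠ 0) :
    ∃ m, ∀ k, v ∈ G k ↔ k ≤ m := by
  classical
  have hex : ∃ k, v ∉ G k := ⟨p, by simpa [hp] using hv⟩
  have hpos : Nat.find hex ≠ 0 := by
    intro h
    exact Nat.find_spec hex (by simp [h, h0])
  refine ⟨Nat.find hex - 1, fun k => ⟨fun hk => ?_, fun hk => ?_⟩⟩
  · by_contra hlt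
    exact Nat.find_spec hex (hG (by omega : Nat.find hex ≤ k) hk)
  · by_contra hk'
    have := Nat.find_min' hex hk'
    omega

/-- Lifting an adapted basis from the quotient by a line: an element of `G k` is a combination of
the lifts plus a multiple of `v`, and this multiple vanishes unless `v` itself lies in `G k`. -/
theorem eq_span_of_map_mkQ_eq_span {V : Type*} [AddCommGroup V] [Module K V]
    {G : ℕ → Submodule K V} (hG : Antitone G) {v : V} {m : ℕ} (hm : ∀ k, v ∈ G k ↔ k ≤ m)
    {ι : Type*} {w : ι → V} {g : ι → ℕ} (hw : ∀ l, w l ∈ G (g l))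
    (hspan : ∀ k, (G k).map (K ∙ v).mkQ = span K (((K ∙ v).mkQ ∘ w) '' {l | k ≤ g l})) (k : ℕ) :
    G k = span K (Sum.elim (fun _ : Unit => v) w '' {l | k ≤ Sum.elim (fun _ : Unit => m) g l}) := by
  apply le_antisymm
  · intro x hx
    have h1 : (K ∙ v).mkQ x ∈ (G k).map (K ∙ v).mkQ := mem_map_of_mem hx
    rw [hspan k, Set.image_comp, span_image] at h1
    obtain ⟨y, hy, hyx⟩ := h1
    have hyG : y ∈ G k := by
      refine span_le.2 ?_ hy
      rintro _ ⟨l, hl, rfl⟩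
      exact hG hl (hw l)
    have hy' : y ∈ span K (Sum.elim (fun _ : Unit => v) w ''
        {l | k ≤ Sum.elim (fun _ : Unit => m) g l}) := by
      refine span_mono ?_ hy
      rintro _ ⟨l, hl, rfl⟩
      exact ⟨Sum.inr l, hl, rfl⟩
    have hd : x - y ∈ K ∙ v := by
      rw [← Submodule.Quotient.mk_eq_zero, ← mkQ_apply, map_sub, hyx, sub_self]
    obtain ⟨a, ha⟩ := mem_span_singleton.1 hd
    have hx' : x = y + a • v := by rw [ha]; abel
    by_cases hk : k ≤ m
    · rw [hx']
      refine add_mem hy' (smul_mem _ _ (subset_span ⟨Sum.inl (), hk, rfl⟩))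
    · have ha0 : a = 0 := by
        by_contra ha0
        apply hk
        rw [← hm]
        have : a • v ∈ G k := by rw [ha]; exact sub_mem hx hyG
        exact ((G k).smul_mem_iff ha0).1 this
      rw [hx', ha0, zero_smul, add_zero]
      exact hy'
  · rw [span_le]
    rintro _ ⟨l | l, hl, rfl⟩
    · exact (hm k).2 hl
    · exact hG hl (hw l)

/-- Two flags of subspaces admit a common adapted basis. -/
theorem exists_basis_adapted_to_flags (N : ℕ) : ∀ (V : Type*) [AddCommGroup V] [Module K V]
    [FiniteDimensional K V], finrank K V = N → ∀ F G : ℕ → Submodule K V, Antitone F → Antitone G →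
    F 0 = ⊤ → G 0 = ⊤ → (∃ p, F p = ⊥) → (∃ p, G p = ⊥) →
    ∃ (ι : Type) (_ : Fintype ι) (b : Basis ι K V) (f g : ι → ℕ),
      (∀ i, F i = span K (b '' {l | i ≤ f l})) ∧ ∀ i, G i = span K (b '' {l | i ≤ g l}) := by
  induction N with
  | zero =>
    intro V _ _ _ hV F G hF hG hF0 hG0 hFp hGp
    have : Subsingleton V := finrank_zero_iff.1 hV
    exact ⟨Empty, inferInstance, Basis.empty V, fun _ => 0, fun _ => 0,
      fun i => Subsingleton.elim _ _, fun i => Subsingleton.elim _ _⟩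
  | succ N ih =>
    intro V _ _ _ hV F G hF hG hF0 hG0 hFp hGp
    classical
    have hVn : Nontrivial V := nontrivial_of_finrank_pos (R := K) (by omega)
    obtain ⟨p, hp⟩ := hGp
    have hfind := Nat.find_spec hFp
    have hmin := fun k => Nat.find_min (m := k) hFp
    set p₁ := Nat.find hFp
    have hp₁ : p₁ ≠ 0 := by
      intro h
      rw [h, hF0] at hfind
      exact top_ne_bot hfind
    -- `v` comes from the last nonzero step of `F`, hence lies in every nonzero step. This is what
    -- allows corrections by multiples of `v` below.
    obtain ⟨v, hvF, hv⟩ := (Submodule.ne_bot_iff _).1 (hmin (p₁ - 1) (by omega))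
    obtain ⟨mG, hmG⟩ := exists_mem_iff_le G hG hG0 hp hv
    have hmF : ∀ k, v ∈ F k ↔ k ≤ p₁ - 1 := by
      refine fun k => ⟨fun hk => ?_, fun hk => hF hk hvF⟩
      by_contra hlt
      have : v ∈ F p₁ := hF (by omega) hk
      rw [hfind] at this
      exact hv (by simpa using this)
    have hrank : finrank K (V ⧸ (K ∙ v)) = N := by
      have h1 := finrank_span_singleton (K := K) hv
      have h2 := Submodule.finrank_quotient_add_finrank (K ∙ v)
      omega
    obtain ⟨ι, hι, b, f, g, hf, hg⟩ := ih (V ⧸ (K ∙ v)) hrank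
      (fun k => (F k).map (K ∙ v).mkQ) (fun k => (G k).map (K ∙ v).mkQ)
      (fun a b hab => map_mono (hF hab)) (fun a b hab => map_mono (hG hab))
      (by simp [hF0]) (by simp [hG0])
      ⟨p₁, by simp [hfind]⟩ ⟨p, by simp [hp]⟩
    -- A lift chosen in `G (g l)` differs from a lift in `F (f l)` by a multiple of `v`, which lies
    -- in `F (f l)`; so the first lift is in both.
    have hw : ∀ l, ∃ w ∈ F (f l) ⊓ G (g l), (K ∙ v).mkQ w = b l := by
      intro l
      have h1 : b l ∈ (F (f l)).map (K ∙ v).mkQ := by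
        rw [hf]; exact subset_span ⟨l, le_refl (f l), rfl⟩
      have h2 : b l ∈ (G (g l)).map (K ∙ v).mkQ := by
        rw [hg]; exact subset_span ⟨l, le_refl (g l), rfl⟩
      obtain ⟨x, hx, hxl⟩ := h1
      obtain ⟨y, hy, hyl⟩ := h2
      refine ⟨y, ⟨?_, hy⟩, hyl⟩
      have hle : f l ≤ p₁ - 1 := by
        by_contra hlt
        have : x ∈ F p₁ := hF (by omega) hx
        rw [hfind, mem_bot] at this
        rw [this, map_zero] at hxl
        exact b.ne_zero l hxl.symm
      have hd : y - x ∈ K ∙ v := by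
        rw [← Submodule.Quotient.mk_eq_zero, ← mkQ_apply, map_sub, hxl, hyl, sub_self]
      have : y - x ∈ F (f l) := by
        refine (span_singleton_le_iff_mem v _).2 ((hmF _).2 hle) hd
      simpa using add_mem this hx
    choose w hwm hwb using hw
    have hbw : (K ∙ v).mkQ ∘ w = b := funext hwb
    have hli : LinearIndependent K (Sum.elim (fun _ : Unit => v) w) := by
      refine LinearIndependent.sumElim_of_quotient (M' := K ∙ v)
        (f := fun _ : Unit => (⟨v, mem_span_singleton_self v⟩ : K ∙ v)) ?_ w ?_
      · refine LinearIndependent.of_subsingleton () ?_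
        simpa [Subtype.ext_iff] using hv
      · have : (Submodule.Quotient.mk ∘ w : ι → V ⧸ (K ∙ v)) = b := hbw
        rw [this]
        exact b.linearIndependent
    have hFs := eq_span_of_map_mkQ_eq_span hF hmF (fun l => (hwm l).1) (by
      intro k; rw [hbw]; exact hf k)
    have hGs := eq_span_of_map_mkQ_eq_span hG hmG (fun l => (hwm l).2) (by
      intro k; rw [hbw]; exact hg k)
    refine ⟨Unit ⊕ ι, inferInstance, Basis.mk hli ?_, Sum.elim (fun _ => p₁ - 1) f,
      Sum.elim (fun _ => mG) g, ?_, ?_⟩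
    · have := hFs 0
      rw [hF0] at this
      rw [this]
      exact span_mono (Set.image_subset_range _ _)
    · intro i; rw [Basis.coe_mk]; exact hFs i
    · intro i; rw [Basis.coe_mk]; exact hGs i

end RelativePosition

/-! ### Subspaces spanned by parts of a basis. -/

section CoordinateSubspaces

variable {K V ι : Type*} [Field K] [AddCommGroup V] [Module K V] (b : Basis ι K V)

theorem span_image_inf (s t : Set ι) :
    span K (b '' s) ⊓ span K (b '' t) = span K (b '' (s ∩ t)) := by
  ext m
  simp only [mem_inf, b.mem_span_image, Set.subset_inter_iff]

theorem finrank_span_image [Fintype ι] (p : ι → Prop) [DecidablePred p] :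
    finrank K (span K (b '' {l | p l})) = (Finset.univ.filter p).card := by
  have h : LinearIndependent K (fun l : {l // p l} => b l) :=
    b.linearIndependent.comp _ Subtype.val_injective
  have := finrank_span_eq_card h
  rw [Fintype.card_subtype] at this
  rw [← this, Set.image_eq_range]
  rfl

end CoordinateSubspaces

/-! ### Reduction modulo `π`, torsion, and lifting of bases. -/

section Reduction

variable {R K M V : Type*} [CommRing R] [Field K] [Algebra R K] [AddCommGroup M] [Module R M]
  [AddCommGroup V] [Module K V] [Module R V] [IsScalarTower R K V]

/-- `q` exhibits the vector space `V` as the reduction of `M` modulo `π`, and `j` identifies `V`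
with the `π`-torsion of `M`. -/
structure IsReduction (K : Type*) [Field K] [Algebra R K] [Module K V] (π : R)
    (q : M →ₗ[R] V) (j : V →ₗ[R] M) : Prop where
  mul_self : π * π = 0
  surj_algebraMap : Function.Surjective (algebraMap R K)
  algebraMap_eq_zero : ∀ r, algebraMap R K r = 0 ↔ π ∣ r
  surj : Function.Surjective q
  inj : Function.Injective j
  comp : ∀ m, j (q m) = π • m
  ker : ∀ m, q m = 0 → ∃ v, j v = m

variable (K) in
/-- The reduction of a submodule. -/
def red (q : M →ₗ[R] V) (N : Submodule R M) : Submodule K V := span K (q '' N)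

variable (K) in
/-- The torsion of a submodule. -/
def tor (j : V →ₗ[R] M) (N : Submodule R M) : Submodule K V := span K (j ⁻¹' N)

variable {π : R} {q : M →ₗ[R] V} {j : V →ₗ[R] M}

namespace IsReduction

variable (h : IsReduction K π q j)
include h

theorem mem_span_iff {X : Set V} {v : V} : v ∈ span K X ↔ v ∈ span R X := by
  rw [← Submodule.restrictScalars_span R K h.surj_algebraMap X, restrictScalars_mem]

theorem mem_red {N : Submodule R M} {v : V} : v ∈ red K q N ↔ ∃ m ∈ N, q m = v := by
  rw [red, h.mem_span_iff, ← map_coe, span_eq, mem_map]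

theorem mem_tor {N : Submodule R M} {v : V} : v ∈ tor K j N ↔ j v ∈ N := by
  rw [tor, h.mem_span_iff, ← comap_coe, span_eq, mem_comap]

theorem q_smul (m : M) : q (π • m) = 0 := by
  rw [map_smul, ← IsScalarTower.algebraMap_smul K π (q m), (h.algebraMap_eq_zero π).2 dvd_rfl,
    zero_smul]

theorem q_j (v : V) : q (j v) = 0 := by
  obtain ⟨m, rfl⟩ := h.surj v
  rw [h.comp, h.q_smul]

theorem smul_j (v : V) : π • j v = 0 := by
  rw [← h.comp, h.q_j, map_zero]

theorem exists_j_of_smul_eq_zero {m : M} (hm : π • m = 0) : ∃ v, j v = m :=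
  h.ker m (h.inj (by rw [h.comp, hm, map_zero]))

theorem algebraMap_smul_surj (c : K) : ∃ r : R, ∀ v : V, r • v = c • v := by
  obtain ⟨r, rfl⟩ := h.surj_algebraMap c
  exact ⟨r, fun v => (IsScalarTower.algebraMap_smul K r v).symm⟩

/-- Lifts of a basis of the reduction form a basis. -/
theorem exists_basis_of_lift {ι : Type*} [Fintype ι] (B : Basis ι K V) (b : ι → M)
    (hb : ∀ l, q (b l) = B l) : ∃ b' : Basis ι R M, ∀ l, b' l = b l := by
  have hzero : ∀ r : ι → R, q (∑ l, r l • b l) = 0 → ∀ l, π ∣ r l := by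
    intro r hr l
    have key : q (∑ l, r l • b l) = ∑ l, algebraMap R K (r l) • B l := by
      simp [map_sum, hb]
    rw [key] at hr
    exact (h.algebraMap_eq_zero _).1 (Fintype.linearIndependent_iff.1 B.linearIndependent _ hr l)
  have hli : LinearIndependent R b := by
    rw [Fintype.linearIndependent_iff]
    intro r hr l
    -- A relation has coefficients divisible by `π`. Writing `r = πs`, the sum with coefficients `s`
    -- is killed by `π`, so `s` is divisible by `π` as well, and `π² = 0` gives `r = 0`.
    choose s hs using hzero r (by rw [hr, map_zero])
    have h1 : j (q (∑ l, s l • b l)) = 0 := by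
      rw [h.comp, Finset.smul_sum, ← hr]
      exact Finset.sum_congr rfl fun l _ => by rw [hs l, mul_smul]
    obtain ⟨u, hu⟩ := hzero s (h.inj (by rw [h1, map_zero])) l
    rw [hs l, hu, ← mul_assoc, h.mul_self, zero_mul]
  have hq : ∀ m, ∃ y ∈ span R (Set.range b), q y = q m := by
    intro m
    choose r hr using fun l => h.surj_algebraMap (B.repr (q m) l)
    refine ⟨∑ l, r l • b l, sum_mem fun l _ => smul_mem _ _ (subset_span ⟨l, rfl⟩), ?_⟩
    conv_rhs => rw [← B.sum_repr (q m)]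
    simp [map_sum, hb, ← hr]
  refine ⟨Basis.mk hli ?_, fun l => Basis.mk_apply hli _ l⟩
  intro m _
  obtain ⟨y, hy, hym⟩ := hq m
  obtain ⟨v, hv⟩ := h.ker (m - y) (by rw [map_sub, hym, sub_self])
  obtain ⟨m', rfl⟩ := h.surj v
  obtain ⟨y', hy', hym'⟩ := hq m'
  -- Nakayama by hand: the module is the span plus `π` times itself, and one substitution suffices
  -- because `π • m'` depends only on the reduction of `m'`.
  have : m = y + π • y' := by
    rw [← h.comp, hym', hv]; abel
  rw [this]
  exact add_mem hy (smul_mem _ _ hy')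

/-- The reduction of a basis is a basis. -/
theorem exists_basis_reduction {ι : Type*} [Fintype ι] (b : Basis ι R M) :
    ∃ B : Basis ι K V, ∀ l, q (b l) = B l := by
  have hli : LinearIndependent K (fun l => q (b l)) := by
    rw [Fintype.linearIndependent_iff]
    intro c hc l
    choose r hr using fun l => h.surj_algebraMap (c l)
    obtain ⟨v, hv⟩ := h.ker (∑ l, r l • b l) (by
      rw [← hc, map_sum]
      exact Finset.sum_congr rfl fun l _ => by
        rw [map_smul, ← hr, IsScalarTower.algebraMap_smul])
    obtain ⟨m, rfl⟩ := h.surj v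
    rw [h.comp] at hv
    have h1 := congrArg (fun m => b.repr m l) hv
    simp only [b.repr_sum_self, map_smul, Finsupp.smul_apply, smul_eq_mul] at h1
    rw [← hr, h.algebraMap_eq_zero, ← h1]
    exact dvd_mul_right _ _
  refine ⟨Basis.mk hli ?_, fun l => (Basis.mk_apply hli _ l).symm⟩
  intro v _
  obtain ⟨m, rfl⟩ := h.surj v
  rw [← b.sum_repr m, map_sum]
  refine sum_mem fun l _ => ?_
  rw [map_smul, ← IsScalarTower.algebraMap_smul K]
  exact smul_mem _ _ (subset_span ⟨l, rfl⟩)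

theorem mem_span_smul_iff {ι : Type*} {b : ι → M} {B : ι → V} (hb : ∀ l, q (b l) = B l)
    (s : Set ι) {m : M} :
    m ∈ span R ((fun l => π • b l) '' s) ↔ ∃ v ∈ span K (B '' s), j v = m := by
  have : (fun l => π • b l) '' s = j '' (B '' s) := by
    rw [Set.image_image]
    exact Set.image_congr fun l _ => by rw [← hb, h.comp]
  rw [this, span_image, mem_map]
  simp only [h.mem_span_iff]

theorem exists_of_mem_span {ι : Type*} [Fintype ι] {b : ι → M} {B : Basis ι K V}
    (hb : ∀ l, q (b l) = B l) (s : Set ι) {m : M} (hm : m ∈ span R (b '' s)) (hq : q m = 0) :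
    ∃ v ∈ span K (B '' s), j v = m := by
  obtain ⟨f, hf, rfl⟩ := (Finsupp.mem_span_image_iff_linearCombination R).1 hm
  have h1 : ∀ l, π ∣ f l := by
    intro l
    rw [Finsupp.linearCombination_apply, Finsupp.sum_fintype _ _ (by simp), map_sum] at hq
    have key : ∑ l, algebraMap R K (f l) • B l = 0 := by
      rw [← hq]
      simp [hb]
    exact (h.algebraMap_eq_zero _).1 (Fintype.linearIndependent_iff.1 B.linearIndependent _ key l)
  rw [← h.mem_span_smul_iff hb]
  rw [Finsupp.linearCombination_apply]
  refine sum_mem fun l hl => ?_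
  obtain ⟨u, hu⟩ := h1 l
  simp only
  rw [hu, mul_comm, mul_smul]
  exact smul_mem _ _ (subset_span ⟨l, hf hl, rfl⟩)

end IsReduction

end Reduction

/-! ### Flags adapted to a labelled basis, and twisted families. -/

section AdaptedFlags

variable {R K M V : Type*} [CommRing R] [Field K] [Algebra R K] [AddCommGroup M] [Module R M]
  [AddCommGroup V] [Module K V] [Module R V] [IsScalarTower R K V]
  {π : R} {q : M →ₗ[R] V} {j : V →ₗ[R] M}

/-- The conditions on a flag `y₂ ⊇ y₁` which make `y₂[π] ⊇ y₁ ⊇ πy₂` a flag. -/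
structure IsPreflag (π : R) (y₂ y₁ : Submodule R M) : Prop where
  le : y₁ ≤ y₂
  smul_mem : ∀ m ∈ y₂, π • m ∈ y₁
  smul_eq_zero : ∀ m ∈ y₁, π • m = 0

/-- A flag spanned by the vectors `b l` with label `≥ 3` and the vectors `π • b l` with
label `≥ 1`, respectively `≥ 2`. -/
structure FlagAdapted {κ : Type*} (π : R) (b : κ → M) (r : κ → ℕ) (y₂ y₁ : Submodule R M) :
    Prop where
  top_eq : y₂ = span R (b '' {l | 3 ≤ r l}) ⊔ span R ((fun l => π • b l) '' {l | 1 ≤ r l})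
  bot_eq : y₁ = span R ((fun l => π • b l) '' {l | 2 ≤ r l})

theorem FlagAdapted.map {κ M' : Type*} [AddCommGroup M'] [Module R M'] {b : κ → M} {r : κ → ℕ}
    {y₂ y₁ : Submodule R M} (h : FlagAdapted π b r y₂ y₁) (φ : M →ₗ[R] M') :
    FlagAdapted π (φ ∘ b) r (y₂.map φ) (y₁.map φ) where
  top_eq := by
    rw [h.top_eq, Submodule.map_sup, map_span, map_span, Set.image_image, Set.image_image]
    simp only [map_smul, Function.comp_apply]
  bot_eq := by
    rw [h.bot_eq, map_span, Set.image_image]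
    simp

theorem FlagAdapted.reindex {κ κ' : Type*} {b : κ → M} {r : κ → ℕ} {y₂ y₁ : Submodule R M}
    (h : FlagAdapted π b r y₂ y₁) (e : κ' ≃ κ) :
    FlagAdapted π (b ∘ e) (r ∘ e) y₂ y₁ := by
  have key : ∀ (b : κ → M) (i : ℕ), (b ∘ e) '' {l | i ≤ (r ∘ e) l} = b '' {l | i ≤ r l} := by
    intro b i
    rw [Set.image_comp]
    congr 1
    exact e.image_preimage {l | i ≤ r l}
  exact ⟨by rw [key, h.top_eq, ← key (fun l => π • b l)]; rfl,
    by rw [h.bot_eq, ← key (fun l => π • b l)]; rfl⟩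

variable (K) in
/-- The flag of the torsion points of `(y₂, y₁)`, transported to `V`. -/
def reducedFlag (q : M →ₗ[R] V) (j : V →ₗ[R] M) (y₂ y₁ : Submodule R M) : ℕ → Submodule K V
  | 0 => ⊤
  | 1 => tor K j y₂
  | 2 => tor K j y₁
  | 3 => red K q y₂
  | _ => ⊥

namespace IsReduction

variable (h : IsReduction K π q j)
include h

theorem reducedFlag_antitone {y₂ y₁ : Submodule R M} (hy : IsPreflag π y₂ y₁) :
    Antitone (reducedFlag K q j y₂ y₁) := by
  refine antitone_nat_of_succ_le fun k => ?_
  match k with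
  | 0 => exact le_top
  | 1 => exact fun v hv => h.mem_tor.2 (hy.le (h.mem_tor.1 hv))
  | 2 =>
    intro v hv
    obtain ⟨m, hm, rfl⟩ := h.mem_red.1 hv
    exact h.mem_tor.2 (by rw [h.comp]; exact hy.smul_mem m hm)
  | k + 3 => exact bot_le

theorem mem_span_image_iff {κ : Type*} (B : Basis κ K V) (s : Set κ) (l : κ) :
    B l ∈ span K (B '' s) ↔ l ∈ s := by
  refine ⟨fun hl => ?_, fun hl => subset_span ⟨l, hl, rfl⟩⟩
  rw [B.mem_span_image, B.repr_self, Finsupp.support_single _ one_ne_zero] at hl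
  simpa using hl

variable {κ : Type*} [Fintype κ] {b : κ → M} {B : Basis κ K V} (hb : ∀ l, q (b l) = B l)
  {r : κ → ℕ} {y₂ y₁ : Submodule R M}
include hb

/-- A vector `π • b l` is `j (B l)`, and a vector `b l` in `y₂` contributes `B l` both to the
reduction and, through its multiple by `π`, to the torsion. Labels therefore record the depth in the
reduced chain. -/
theorem reducedFlag_eq_span (hr : ∀ l, r l ≤ 3) (hy : FlagAdapted π b r y₂ y₁) (i : ℕ) :
    reducedFlag K q j y₂ y₁ i = span K (B '' {l | i ≤ r l}) := by
  have hsmul : ∀ v ∈ span K (B '' {l | 1 ≤ r l}), j v ∈ y₂ := by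
    intro v hv
    rw [hy.top_eq]
    exact mem_sup_right ((h.mem_span_smul_iff hb _).2 ⟨v, hv, rfl⟩)
  match i with
  | 0 => simp [reducedFlag]
  | 1 =>
    ext v
    rw [reducedFlag, h.mem_tor]
    refine ⟨fun hv => ?_, hsmul v⟩
    rw [hy.top_eq, mem_sup] at hv
    obtain ⟨m, hm, m', hm', hmm⟩ := hv
    obtain ⟨v', hv', rfl⟩ := (h.mem_span_smul_iff hb _).1 hm'
    obtain ⟨u, hu, rfl⟩ := h.exists_of_mem_span hb _ hm (by
      rw [eq_sub_of_add_eq hmm, map_sub, h.q_j, h.q_j, sub_self])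
    rw [← map_add] at hmm
    rw [← h.inj hmm]
    refine add_mem (span_mono (Set.image_mono ?_) hu) hv'
    intro l hl
    exact le_trans (by norm_num) (show 3 ≤ r l from hl)
  | 2 =>
    ext v
    rw [reducedFlag, h.mem_tor, hy.bot_eq, h.mem_span_smul_iff hb]
    exact ⟨fun ⟨u, hu, huv⟩ => h.inj huv ▸ hu, fun hv => ⟨v, hv, rfl⟩⟩
  | 3 =>
    apply le_antisymm
    · intro v hv
      obtain ⟨m, hm, rfl⟩ := h.mem_red.1 hv
      rw [hy.top_eq, mem_sup] at hm
      obtain ⟨m, hm, m', hm', rfl⟩ := hm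
      obtain ⟨v', hv', rfl⟩ := (h.mem_span_smul_iff hb _).1 hm'
      rw [map_add, h.q_j, add_zero, h.mem_span_iff]
      have := mem_map_of_mem (f := q) hm
      rw [map_span, Set.image_image] at this
      simpa only [hb] using this
    · rw [span_le]
      rintro _ ⟨l, hl, rfl⟩
      refine h.mem_red.2 ⟨b l, ?_, hb l⟩
      rw [hy.top_eq]
      exact mem_sup_left (subset_span ⟨l, hl, rfl⟩)
  | i + 4 =>
    have : {l | i + 4 ≤ r l} = ∅ := by
      ext l
      have := hr l
      simp only [Set.mem_ofPred_eq, Set.mem_empty_iff_false, iff_false]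
      omega
    simp [this, reducedFlag]

/-- An element of `y₂` agrees modulo `π` with a combination of the vectors of label at least `3`,
and the difference is a torsion element of `y₂`. Hence the reduced chain determines the flag once
those vectors are known to lie in `y₂`. -/
theorem flagAdapted_of_span (hpre : IsPreflag π y₂ y₁)
    (hy : ∀ i, 1 ≤ i → i ≤ 3 → reducedFlag K q j y₂ y₁ i = span K (B '' {l | i ≤ r l}))
    (hmem : ∀ l, 3 ≤ r l → b l ∈ y₂) : FlagAdapted π b r y₂ y₁ := by
  have h1 := hy 1 le_rfl (by norm_num)
  have h2 := hy 2 (by norm_num) (by norm_num)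
  have h3 := hy 3 (by norm_num) (by norm_num)
  simp only [reducedFlag] at h1 h2 h3
  constructor
  · apply le_antisymm
    · intro m hm
      have hq : q m ∈ red K q y₂ := h.mem_red.2 ⟨m, hm, rfl⟩
      rw [h3, h.mem_span_iff] at hq
      have : B '' {l | 3 ≤ r l} = q '' (b '' {l | 3 ≤ r l}) := by
        rw [Set.image_image]; simp only [hb]
      rw [this, span_image] at hq
      obtain ⟨m', hm', hmm⟩ := hq
      have hm'y : m' ∈ y₂ := by
        refine span_le.2 ?_ hm'
        rintro _ ⟨l, hl, rfl⟩
        exact hmem l hl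
      obtain ⟨v, hv⟩ := h.ker (m - m') (by rw [map_sub, hmm, sub_self])
      have hvt : v ∈ tor K j y₂ := h.mem_tor.2 (by rw [hv]; exact sub_mem hm hm'y)
      rw [h1] at hvt
      rw [← add_sub_cancel m' m, ← hv]
      exact add_mem (mem_sup_left hm')
        (mem_sup_right ((h.mem_span_smul_iff hb _).2 ⟨v, hvt, rfl⟩))
    · refine sup_le (span_le.2 ?_) ?_
      · rintro _ ⟨l, hl, rfl⟩
        exact hmem l hl
      · intro m hm
        obtain ⟨v, hv, rfl⟩ := (h.mem_span_smul_iff hb _).1 hm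
        rw [← h1] at hv
        exact h.mem_tor.1 hv
  · ext m
    rw [h.mem_span_smul_iff hb, ← h2]
    constructor
    · intro hm
      obtain ⟨v, rfl⟩ := h.exists_j_of_smul_eq_zero (hpre.smul_eq_zero m hm)
      exact ⟨v, h.mem_tor.2 hm, rfl⟩
    · rintro ⟨v, hv, rfl⟩
      exact h.mem_tor.1 hv

omit [Fintype κ] hb in
theorem isPreflag_of_flagAdapted (hy : FlagAdapted π b r y₂ y₁) : IsPreflag π y₂ y₁ where
  le := by
    rw [hy.top_eq, hy.bot_eq]
    refine le_trans (span_mono (Set.image_mono ?_)) le_sup_right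
    intro l hl
    exact le_trans (by norm_num) (show 2 ≤ r l from hl)
  smul_mem m hm := by
    rw [hy.top_eq, mem_sup] at hm
    obtain ⟨m, hm, m', hm', rfl⟩ := hm
    have h1 : π • m' = 0 := by
      have : span R ((fun l => π • b l) '' {l | 1 ≤ r l}) ≤ LinearMap.ker (LinearMap.lsmul R M π) := by
        rw [span_le]
        rintro _ ⟨l, hl, rfl⟩
        simp [smul_smul, h.mul_self]
      simpa using this hm'
    rw [smul_add, h1, add_zero, hy.bot_eq]
    have h2 := mem_map_of_mem (f := LinearMap.lsmul R M π) hm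
    rw [map_span, Set.image_image] at h2
    refine span_mono (Set.image_mono ?_) h2
    intro l hl
    exact le_trans (by norm_num) (show 3 ≤ r l from hl)
  smul_eq_zero m hm := by
    have : y₁ ≤ LinearMap.ker (LinearMap.lsmul R M π) := by
      rw [hy.bot_eq, span_le]
      rintro _ ⟨l, hl, rfl⟩
      simp [smul_smul, h.mul_self]
    simpa using this hm

end IsReduction

section Pairs

variable {τ ρ : Type*}

/-- The second member of a pair of flags in normal form is adapted to the twisted family. -/
def twist (π : R) (b : (τ ⊕ τ) ⊕ ρ → M) : (τ ⊕ τ) ⊕ ρ → M :=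
  Sum.elim (Sum.elim (fun i => b (Sum.inl (Sum.inl i)) + π • b (Sum.inl (Sum.inr i)))
    (fun i => b (Sum.inl (Sum.inr i)))) fun p => b (Sum.inr p)

/-- The labels of a family with twisted part `τ ⊕ τ`. -/
def twistLabel (f : ρ → ℕ) : (τ ⊕ τ) ⊕ ρ → ℕ :=
  Sum.elim (Sum.elim (fun _ => 3) fun _ => 0) f

theorem twistLabel_le {f : ρ → ℕ} (hf : ∀ l, f l ≤ 3) (l : (τ ⊕ τ) ⊕ ρ) : twistLabel f l ≤ 3 := by
  rcases l with (l | l) | l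
  · exact le_rfl
  · exact Nat.zero_le _
  · exact hf l

theorem IsReduction.q_twist (h : IsReduction K π q j) (b : (τ ⊕ τ) ⊕ ρ → M) (l : (τ ⊕ τ) ⊕ ρ) :
    q (twist π b l) = q (b l) := by
  rcases l with (l | l) | l
  · simp [twist, -map_smul, h.q_smul]
  · rfl
  · rfl

end Pairs

end AdaptedFlags

/-! ### Existence of the normal form of a pair of flags. -/

section NormalForm

variable {R K M V : Type*} [CommRing R] [Field K] [Algebra R K] [AddCommGroup M] [Module R M]
  [AddCommGroup V] [Module K V] [Module R V] [IsScalarTower R K V]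
  {π : R} {q : M →ₗ[R] V} {j : V →ₗ[R] M}

theorem exists_basis_extend [FiniteDimensional K V] {ι : Type*} {v : ι → V}
    (hv : LinearIndependent K v) :
    ∃ (N : ℕ) (B : Basis (ι ⊕ Fin N) K V), ∀ l, B (Sum.inl l) = v l := by
  have hfin := Module.Finite.finite_basis (Basis.sumExtend hv)
  have hext : Finite (Basis.sumExtendIndex hv) := @Finite.sum_right _ _ hfin
  obtain ⟨N, ⟨e⟩⟩ := Finite.exists_equiv_fin (Basis.sumExtendIndex hv)
  refine ⟨N, (Basis.sumExtend hv).reindex (Equiv.sumCongr (Equiv.refl _) e), fun l => ?_⟩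
  simp [Basis.sumExtend]
  rfl

namespace IsReduction

variable (h : IsReduction K π q j)
include h

/-- In an adapted basis, the classes of the vectors that measure the failure of `y₂ ∩ x₂` to lift
`πy₂ ∩ πx₂` are linearly independent modulo `y₂[π] + x₂[π]`. -/
theorem linearIndependent_twist {y₂ x₂ : Submodule R M} {ι : Type*} [Fintype ι] (B : Basis ι K V)
    (f g : ι → ℕ) (hy : ∀ l, 1 ≤ f l → B l ∈ tor K j y₂) (hx : ∀ l, 1 ≤ g l → B l ∈ tor K j x₂)
    (hyx : red K q (y₂ ⊓ x₂) = span K (B '' {l | 4 ≤ f l}))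
    (w w' : {l // f l = 3 ∧ g l = 3} → M) (hw : ∀ l, w l ∈ y₂) (hwB : ∀ l, q (w l) = B l)
    (hw' : ∀ l, w' l ∈ x₂) (d : {l // f l = 3 ∧ g l = 3} → V) (hd : ∀ l, j (d l) = w' l - w l) :
    LinearIndependent K (Sum.elim (Sum.elim (fun l : {l // f l = 3 ∧ g l = 3} => B l) d)
      fun l : {l // ¬(f l = 3 ∧ g l = 3) ∧ ¬(f l = 0 ∧ g l = 0)} => B l) := by
  classical
  rw [Fintype.linearIndependent_iff]
  intro c hc
  simp only [Fintype.sum_sum_type, Sum.elim_inl, Sum.elim_inr] at hc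
  have hmem : ∀ l, ¬(f l = 0 ∧ g l = 0) → B l ∈ tor K j y₂ ⊔ tor K j x₂ := by
    intro l hl
    by_cases h0 : f l = 0
    · exact mem_sup_right (hx l (by omega))
    · exact mem_sup_left (hy l (by omega))
  have hsum : ∑ l, c (Sum.inl (Sum.inr l)) • d l ∈ tor K j y₂ ⊔ tor K j x₂ := by
    have : ∑ l, c (Sum.inl (Sum.inr l)) • d l =
        -(∑ l, c (Sum.inl (Sum.inl l)) • B l + ∑ l, c (Sum.inr l) • B l) := by
      rw [eq_neg_iff_add_eq_zero, ← hc]; abel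
    rw [this]
    refine neg_mem (add_mem (sum_mem fun l _ => smul_mem _ _ (hmem _ ?_))
      (sum_mem fun l _ => smul_mem _ _ (hmem _ l.2.2)))
    have := l.2.1
    omega
  obtain ⟨u, hu, u', hu', huu⟩ := mem_sup.1 hsum
  choose s hs using fun l : {l // f l = 3 ∧ g l = 3} =>
    h.algebraMap_smul_surj (c (Sum.inl (Sum.inr l)))
  have hj : j u + j u' = ∑ l, s l • w' l - ∑ l, s l • w l := by
    rw [← map_add, huu, map_sum, ← Finset.sum_sub_distrib]
    exact Finset.sum_congr rfl fun l _ => by rw [← hs, map_smul, hd, smul_sub]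
  -- If a combination of the `d l` lies in `y₂[π] + x₂[π]`, the same combination of the `w l` can be
  -- corrected by torsion so as to lie in `y₂ ∩ x₂`. Its reduction then involves only labels at
  -- least `4`, whereas every index summed over has label exactly `3`.
  have hz : (∑ l, s l • w l) + j u ∈ y₂ ⊓ x₂ := by
    refine ⟨add_mem (sum_mem fun l _ => smul_mem _ _ (hw l)) (h.mem_tor.1 hu), ?_⟩
    have : (∑ l, s l • w l) + j u = (∑ l, s l • w' l) - j u' := by
      rw [eq_sub_iff_add_eq, add_assoc, hj]; abel
    rw [this]
    exact sub_mem (sum_mem fun l _ => smul_mem _ _ (hw' l)) (h.mem_tor.1 hu')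
  have hqz : ∑ l, c (Sum.inl (Sum.inr l)) • B (l : ι) ∈ span K (B '' {l | 4 ≤ f l}) := by
    rw [← hyx, h.mem_red]
    refine ⟨_, hz, ?_⟩
    rw [map_add, h.q_j, add_zero, map_sum]
    exact Finset.sum_congr rfl fun l _ => by rw [map_smul, hwB, hs]
  have hc0 : ∀ l, c (Sum.inl (Sum.inr l)) = 0 := by
    intro l
    rw [B.mem_span_image] at hqz
    by_contra hne
    have hl : (l : ι) ∈ (B.repr (∑ l, c (Sum.inl (Sum.inr l)) • B (l : ι))).support := by
      rw [Finsupp.mem_support_iff, map_sum, Finsupp.finsetSum_apply,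
        Finset.sum_eq_single l]
      · simpa using hne
      · intro l' _ hl'
        have : (l' : ι) ≠ l := fun hh => hl' (Subtype.ext hh)
        simp [this]
      · simp
    have h4 : 4 ≤ f l := hqz hl
    have := l.2.1
    omega
  have hli : LinearIndependent K (Sum.elim (fun l : {l // f l = 3 ∧ g l = 3} => B l)
      fun l : {l // ¬(f l = 3 ∧ g l = 3) ∧ ¬(f l = 0 ∧ g l = 0)} => B l) := by
    have hinj : Function.Injective (Sum.elim (fun l : {l // f l = 3 ∧ g l = 3} => (l : ι))
        fun l : {l // ¬(f l = 3 ∧ g l = 3) ∧ ¬(f l = 0 ∧ g l = 0)} => (l : ι)) := by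
      refine Function.Injective.sumElim Subtype.val_injective Subtype.val_injective ?_
      intro a b hab
      exact b.2.1 (hab ▸ a.2)
    convert B.linearIndependent.comp _ hinj using 1
    ext (l | l) <;> rfl
  have hrest := Fintype.linearIndependent_iff.1 hli
    (Sum.elim (fun l => c (Sum.inl (Sum.inl l))) fun l => c (Sum.inr l)) (by
      simp only [Fintype.sum_sum_type, Sum.elim_inl, Sum.elim_inr]
      rw [← hc]
      simp [hc0])
  rintro ((l | l) | l)
  · exact hrest (Sum.inl l)
  · exact hc0 l
  · exact hrest (Sum.inr l)

/-- Every pair of flags is in normal form with respect to a suitable basis. -/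
theorem exists_twist_adapted [FiniteDimensional K V] {y₂ y₁ x₂ x₁ : Submodule R M}
    (hy : IsPreflag π y₂ y₁) (hx : IsPreflag π x₂ x₁) :
    ∃ (τ ρ : Type) (_ : Fintype τ) (_ : Fintype ρ) (b : Basis ((τ ⊕ τ) ⊕ ρ) R M)
      (f g : ρ → Fin 4), FlagAdapted π b (twistLabel fun l => f l) y₂ y₁ ∧
        FlagAdapted π (twist π b) (twistLabel fun l => g l) x₂ x₁ := by
  classical
  have hanty := h.reducedFlag_antitone hy
  have hantx := h.reducedFlag_antitone hx
  -- The first chain gets the reduction of `y₂ ∩ x₂` as an extra step, so that label `4` marks the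
  -- vectors with a common lift to `y₂` and `x₂`.
  set F : ℕ → Submodule K V := fun k =>
    if k = 4 then red K q (y₂ ⊓ x₂) else reducedFlag K q j y₂ y₁ k with hF
  have hredy : red K q (y₂ ⊓ x₂) ≤ red K q y₂ := by
    intro v hv
    obtain ⟨m, hm, rfl⟩ := h.mem_red.1 hv
    exact h.mem_red.2 ⟨m, hm.1, rfl⟩
  have hredx : red K q (y₂ ⊓ x₂) ≤ red K q x₂ := by
    intro v hv
    obtain ⟨m, hm, rfl⟩ := h.mem_red.1 hv
    exact h.mem_red.2 ⟨m, hm.2, rfl⟩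
  have hFanti : Antitone F := by
    refine antitone_nat_of_succ_le fun k => ?_
    match k with
    | 0 => exact hanty (Nat.le_succ 0)
    | 1 => exact hanty (Nat.le_succ 1)
    | 2 => exact hanty (Nat.le_succ 2)
    | 3 => exact hredy
    | k + 4 => exact bot_le
  obtain ⟨ι, hι, B, f, g, hBf, hBg⟩ := exists_basis_adapted_to_flags (K := K) _ V rfl F
    (reducedFlag K q j x₂ x₁) hFanti hantx rfl rfl ⟨5, rfl⟩ ⟨4, rfl⟩
  have hmemF : ∀ l k, k ≤ f l → B l ∈ F k := fun l k hk => by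
    rw [hBf]; exact subset_span ⟨l, hk, rfl⟩
  have hmemG : ∀ l k, k ≤ g l → B l ∈ reducedFlag K q j x₂ x₁ k := fun l k hk => by
    rw [hBg]; exact subset_span ⟨l, hk, rfl⟩
  have hf4 : ∀ l, f l ≤ 4 := by
    intro l
    by_contra hlt
    exact B.ne_zero l (by simpa [hF, reducedFlag] using hmemF l 5 (by omega))
  have hg3 : ∀ l, g l ≤ 3 := by
    intro l
    by_contra hlt
    exact B.ne_zero l (by simpa [reducedFlag] using hmemG l 4 (by omega))
  have hfg : ∀ l, 4 ≤ f l → 3 ≤ g l := by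
    intro l hl
    have h1 : B l ∈ reducedFlag K q j x₂ x₁ 3 := hredx (hmemF l 4 hl)
    rw [hBg, h.mem_span_image_iff] at h1
    exact h1
  have hFeq : ∀ i, 1 ≤ i → i ≤ 3 → reducedFlag K q j y₂ y₁ i = F i := by
    intro i h1 h3
    simp only [hF, if_neg (by omega : i ≠ 4)]
  have hw : ∀ l : {l // f l = 3 ∧ g l = 3}, ∃ m ∈ y₂, q m = B l := fun l =>
    h.mem_red.1 (by have := hmemF l 3 l.2.1.ge; rwa [← hFeq 3 (by norm_num) le_rfl] at this)
  have hw' : ∀ l : {l // f l = 3 ∧ g l = 3}, ∃ m ∈ x₂, q m = B l := fun l =>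
    h.mem_red.1 (hmemG l 3 l.2.2.ge)
  choose w hwy hwB using hw
  choose w' hwx hwB' using hw'
  choose d hd using fun l => h.ker (w' l - w l) (by rw [map_sub, hwB, hwB', sub_self])
  have hli := h.linearIndependent_twist B f g (y₂ := y₂) (x₂ := x₂)
    (fun l hl => by have := hmemF l 1 hl; rwa [← hFeq 1 le_rfl (by norm_num)] at this)
    (fun l hl => hmemG l 1 hl) (hBf 4) w w' hwy hwB hwx d hd
  -- Basis vectors of label `(0, 0)` occur in no proper step. They are discarded to make room for
  -- the vectors `d l`, and the independent family is completed arbitrarily.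
  obtain ⟨N, B₁, hB₁⟩ := exists_basis_extend hli
  set B₂ := B₁.reindex (Equiv.sumAssoc _ _ _)
  have hB₂ : ∀ l, B₂ (Sum.map id Sum.inl l) = Sum.elim (Sum.elim
      (fun l : {l // f l = 3 ∧ g l = 3} => B l) d)
      (fun l : {l // ¬(f l = 3 ∧ g l = 3) ∧ ¬(f l = 0 ∧ g l = 0)} => B l) l := by
    intro l
    rw [← hB₁]
    rcases l with l | l <;> simp [B₂]
  -- Outside the bad indices, a vector required to lift to both `y₂` and `x₂` has first label `4`,
  -- so a single lift in the intersection serves.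
  have he : ∀ l : {l // ¬(f l = 3 ∧ g l = 3) ∧ ¬(f l = 0 ∧ g l = 0)},
      ∃ m, q m = B l ∧ (3 ≤ f l → m ∈ y₂) ∧ (3 ≤ g l → m ∈ x₂) := by
    intro l
    by_cases h4 : 4 ≤ f l
    · obtain ⟨m, hm, hmB⟩ := h.mem_red.1 (hmemF l 4 h4)
      exact ⟨m, hmB, fun _ => hm.1, fun _ => hm.2⟩
    · by_cases hf3 : 3 ≤ f l
      · obtain ⟨m, hm, hmB⟩ := h.mem_red.1 (show B l ∈ red K q y₂ by
          have := hmemF l 3 hf3; rwa [← hFeq 3 (by norm_num) le_rfl] at this)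
        refine ⟨m, hmB, fun _ => hm, fun hg => absurd ⟨?_, ?_⟩ l.2.1⟩
        · omega
        · have := hg3 l; omega
      · by_cases hg : 3 ≤ g l
        · obtain ⟨m, hm, hmB⟩ := h.mem_red.1 (hmemG l 3 hg)
          exact ⟨m, hmB, fun hh => absurd hh hf3, fun _ => hm⟩
        · obtain ⟨m, hm⟩ := h.surj (B l)
          exact ⟨m, hm, fun hh => absurd hh hf3, fun hh => absurd hh hg⟩
  choose e heB hey hex using he
  choose u hu using fun l => h.surj (d l)
  choose z hz using fun i : Fin N => h.surj (B₂ (Sum.inr (Sum.inr i)))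
  obtain ⟨b, hb⟩ := h.exists_basis_of_lift B₂ (Sum.elim (Sum.elim w u) (Sum.elim e z)) (by
    rintro ((l | l) | l | l)
    · exact (hwB l).trans (hB₂ (Sum.inl (Sum.inl l))).symm
    · exact (hu l).trans (hB₂ (Sum.inl (Sum.inr l))).symm
    · exact (heB l).trans (hB₂ (Sum.inr l)).symm
    · exact hz l)
  have hqb : ∀ l, q (b l) = B₂ l := by
    rintro ((l | l) | l | l) <;> rw [hb]
    · exact (hwB l).trans (hB₂ (Sum.inl (Sum.inl l))).symm
    · exact (hu l).trans (hB₂ (Sum.inl (Sum.inr l))).symm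
    · exact (heB l).trans (hB₂ (Sum.inr l)).symm
    · exact hz l
  have key : ∀ φ : ι → ℕ, (∀ l, f l = 3 ∧ g l = 3 → φ l = 3) → (∀ l, f l = 0 ∧ g l = 0 → φ l = 0) →
      ∀ i, 1 ≤ i → i ≤ 3 → span K (B '' {l | i ≤ φ l}) = span K (B₂ '' {l | i ≤ twistLabel
        (Sum.elim (fun l : {l // ¬(f l = 3 ∧ g l = 3) ∧ ¬(f l = 0 ∧ g l = 0)} => min (φ l) 3)
          fun _ => 0) l}) := by
    intro φ hφ3 hφ0 i hi1 hi3
    congr 1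
    ext v
    constructor
    · rintro ⟨l, hl, rfl⟩
      have hl' : i ≤ φ l := hl
      by_cases h3 : f l = 3 ∧ g l = 3
      · exact ⟨Sum.inl (Sum.inl ⟨l, h3⟩), hi3, hB₂ (Sum.inl (Sum.inl ⟨l, h3⟩))⟩
      · have h0 : ¬(f l = 0 ∧ g l = 0) := fun h0 => by have := hφ0 l h0; omega
        exact ⟨Sum.inr (Sum.inl ⟨l, h3, h0⟩), le_min hl' hi3, hB₂ (Sum.inr ⟨l, h3, h0⟩)⟩
    · rintro ⟨(l | l) | l | l, hl, rfl⟩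
      · refine ⟨l, ?_, (hB₂ (Sum.inl (Sum.inl l))).symm⟩
        have := hφ3 l l.2
        show i ≤ φ l
        omega
      · have : i ≤ 0 := hl
        omega
      · exact ⟨l, le_trans (show i ≤ min (φ l) 3 from hl) (min_le_left _ _), (hB₂ (Sum.inr l)).symm⟩
      · have : i ≤ 0 := hl
        omega
  have hlab : ∀ φ : ι → ℕ, (fun l => ((Sum.elim
      (fun l : {l // ¬(f l = 3 ∧ g l = 3) ∧ ¬(f l = 0 ∧ g l = 0)} =>
        (⟨min (φ l) 3, by omega⟩ : Fin 4)) (fun _ : Fin N => 0) l : Fin 4) : ℕ)) =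
      Sum.elim (fun l : {l // ¬(f l = 3 ∧ g l = 3) ∧ ¬(f l = 0 ∧ g l = 0)} => min (φ l) 3)
          fun _ => 0 := by
    intro φ
    ext (l | l) <;> rfl
  refine ⟨_, _, inferInstance, inferInstance, b, Sum.elim (fun l => ⟨min (f l) 3, by omega⟩) fun _ => 0,
    Sum.elim (fun l => ⟨min (g l) 3, by omega⟩) fun _ => 0, ?_, ?_⟩
  · rw [hlab]
    refine h.flagAdapted_of_span hqb hy (fun i hi1 hi3 => ?_) ?_
    · rw [hFeq i hi1 hi3, hBf]
      exact key f (fun l hl => hl.1) (fun l hl => hl.1) i hi1 hi3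
    · rintro ((l | l) | l | l) hl <;> rw [hb]
      · exact hwy l
      · exact absurd (show 3 ≤ 0 from hl) (by norm_num)
      · exact hey l (le_trans (show 3 ≤ min (f l) 3 from hl) (min_le_left _ _))
      · exact absurd (show 3 ≤ 0 from hl) (by norm_num)
  · rw [hlab]
    refine h.flagAdapted_of_span (fun l => (h.q_twist b l).trans (hqb l)) hx
      (fun i hi1 hi3 => ?_) ?_
    · rw [hBg]
      exact key g (fun l hl => hl.2) (fun l hl => hl.2) i hi1 hi3
    · rintro ((l | l) | l | l) hl
      -- The second vector `u l` of a block reduces to `d l`, so `π • u l = j (d l)` is exactly the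
      -- difference between the two lifts.
      · have : twist π b (Sum.inl (Sum.inl l)) = w' l := by
          simp only [twist, Sum.elim_inl, Sum.elim_inr, hb]
          rw [← h.comp, hu, hd]; abel
        rw [this]
        exact hwx l
      · exact absurd (show 3 ≤ 0 from hl) (by norm_num)
      · have : twist π b (Sum.inr (Sum.inl l)) = e l := by simp only [twist, Sum.elim_inr, Sum.elim_inl, hb]
        rw [this]
        exact hex l (le_trans (show 3 ≤ min (g l) 3 from hl) (min_le_left _ _))
      · exact absurd (show 3 ≤ 0 from hl) (by norm_num)

end IsReduction

end NormalForm

/-! ### The position `(t, c)`: conjugacy, existence and uniqueness. -/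

section PairPosition

/-- Labels of an adapted basis of a pair of flags with `t` twisted pairs of vectors and `c i j`
untwisted vectors with labels `(i, j)`. -/
abbrev PairIndex (t : ℕ) (c : Fin 4 → Fin 4 → ℕ) : Type :=
  (Fin t ⊕ Fin t) ⊕ (Σ p : Fin 4 × Fin 4, Fin (c p.1 p.2))

/-- The labels with respect to the first flag. -/
def rowLabel {t : ℕ} {c : Fin 4 → Fin 4 → ℕ} : PairIndex t c → ℕ :=
  twistLabel fun p => (p.1.1 : ℕ)

/-- The labels with respect to the second flag. -/
def colLabel {t : ℕ} {c : Fin 4 → Fin 4 → ℕ} : PairIndex t c → ℕ :=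
  twistLabel fun p => (p.1.2 : ℕ)

theorem rowLabel_le {t : ℕ} {c : Fin 4 → Fin 4 → ℕ} (l : PairIndex t c) : rowLabel l ≤ 3 :=
  twistLabel_le (fun p => Nat.le_of_lt_succ p.1.1.2) l

theorem colLabel_le {t : ℕ} {c : Fin 4 → Fin 4 → ℕ} (l : PairIndex t c) : colLabel l ≤ 3 :=
  twistLabel_le (fun p => Nat.le_of_lt_succ p.1.2.2) l

variable {R K M V : Type*} [CommRing R] [Field K] [Algebra R K] [AddCommGroup M] [Module R M]
  [AddCommGroup V] [Module K V] [Module R V] [IsScalarTower R K V]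
  {π : R} {q : M →ₗ[R] V} {j : V →ₗ[R] M}

/-- The pair of flags `(y₂, y₁)`, `(x₂, x₁)` has the normal form described by `t` and `c`. -/
def PairPosition (π : R) (t : ℕ) (c : Fin 4 → Fin 4 → ℕ) (y₂ y₁ x₂ x₁ : Submodule R M) : Prop :=
  ∃ b : Basis (PairIndex t c) R M,
    FlagAdapted π b rowLabel y₂ y₁ ∧ FlagAdapted π (twist π b) colLabel x₂ x₁

theorem twist_map {M' τ ρ : Type*} [AddCommGroup M'] [Module R M'] (φ : M →ₗ[R] M')
    (b : (τ ⊕ τ) ⊕ ρ → M) : twist π (φ ∘ b) = φ ∘ twist π b := by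
  ext ((l | l) | l) <;> simp [twist]

theorem PairPosition.map {t : ℕ} {c : Fin 4 → Fin 4 → ℕ} {y₂ y₁ x₂ x₁ : Submodule R M}
    (h : PairPosition π t c y₂ y₁ x₂ x₁) (φ : M ≃ₗ[R] M) :
    PairPosition π t c (y₂.map (φ : M →ₗ[R] M)) (y₁.map (φ : M →ₗ[R] M))
      (x₂.map (φ : M →ₗ[R] M)) (x₁.map (φ : M →ₗ[R] M)) := by
  obtain ⟨b, hy, hx⟩ := h
  have hb : ⇑(b.map φ) = (φ : M →ₗ[R] M) ∘ b := by ext l; simp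
  refine ⟨b.map φ, ?_, ?_⟩
  · rw [hb]; exact hy.map _
  · rw [hb, twist_map]; exact hx.map _

theorem FlagAdapted.eq_of_eq {κ : Type*} {b : κ → M} {r : κ → ℕ} {y₂ y₁ z₂ z₁ : Submodule R M}
    (hy : FlagAdapted π b r y₂ y₁) (hz : FlagAdapted π b r z₂ z₁) : y₂ = z₂ ∧ y₁ = z₁ :=
  ⟨hy.top_eq.trans hz.top_eq.symm, hy.bot_eq.trans hz.bot_eq.symm⟩

/-- Pairs of flags with the same normal form are conjugate. -/
theorem PairPosition.exists_equiv {t : ℕ} {c : Fin 4 → Fin 4 → ℕ}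
    {y₂ y₁ x₂ x₁ y₂' y₁' x₂' x₁' : Submodule R M} (h : PairPosition π t c y₂ y₁ x₂ x₁)
    (h' : PairPosition π t c y₂' y₁' x₂' x₁') :
    ∃ φ : M ≃ₗ[R] M, (y₂.map (φ : M →ₗ[R] M) = y₂' ∧ y₁.map (φ : M →ₗ[R] M) = y₁') ∧
      x₂.map (φ : M →ₗ[R] M) = x₂' ∧ x₁.map (φ : M →ₗ[R] M) = x₁' := by
  obtain ⟨b, hy, hx⟩ := h
  obtain ⟨b', hy', hx'⟩ := h'
  have hb : ((b.equiv b' (Equiv.refl _) : M ≃ₗ[R] M) : M →ₗ[R] M) ∘ b = b' := by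
    ext l; simp
  refine ⟨b.equiv b' (Equiv.refl _), FlagAdapted.eq_of_eq ?_ hy', FlagAdapted.eq_of_eq ?_ hx'⟩
  · rw [← hb]; exact hy.map _
  · rw [← hb, twist_map]; exact hx.map _

theorem card_filter_pairIndex {t : ℕ} {c : Fin 4 → Fin 4 → ℕ} (P : PairIndex t c → Prop)
    [DecidablePred P] (p₁ p₂ : Prop) [Decidable p₁] [Decidable p₂] (p : Fin 4 → Fin 4 → Prop)
    [∀ a b, Decidable (p a b)] (h₁ : ∀ l, P (Sum.inl (Sum.inl l)) ↔ p₁)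
    (h₂ : ∀ l, P (Sum.inl (Sum.inr l)) ↔ p₂) (h₃ : ∀ l, P (Sum.inr l) ↔ p l.1.1 l.1.2) :
    (Finset.univ.filter P).card = (if p₁ then t else 0) + (if p₂ then t else 0) +
      ∑ a, ∑ b, if p a b then c a b else 0 := by
  rw [Finset.card_filter, Fintype.sum_sum_type, Fintype.sum_sum_type, Fintype.sum_sigma,
    Fintype.sum_prod_type]
  simp only [h₁, h₂, h₃]
  congr 1
  · congr 1 <;> split_ifs <;> simp
  · refine Finset.sum_congr rfl fun a _ => Finset.sum_congr rfl fun b _ => ?_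
    split_ifs <;> simp

/-- The dimension of the intersection of the `i`-th and `k`-th members of the reduced flags of a
pair of flags in normal form. -/
def rankInf (t : ℕ) (c : Fin 4 → Fin 4 → ℕ) (i k : ℕ) : ℕ :=
  (if i ≤ 3 ∧ k ≤ 3 then t else 0) + (if i ≤ 0 ∧ k ≤ 0 then t else 0) +
    ∑ a : Fin 4, ∑ b : Fin 4, if i ≤ a ∧ k ≤ b then c a b else 0

namespace IsReduction

variable (h : IsReduction K π q j)
include h

theorem exists_pairPosition [FiniteDimensional K V] {y₂ y₁ x₂ x₁ : Submodule R M}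
    (hy : IsPreflag π y₂ y₁) (hx : IsPreflag π x₂ x₁) :
    ∃ t c, PairPosition π t c y₂ y₁ x₂ x₁ := by
  classical
  obtain ⟨τ, ρ, _, _, b, f, g, hyb, hxb⟩ := h.exists_twist_adapted hy hx
  let e₁ : (Σ p : Fin 4 × Fin 4, Fin (Fintype.card {l : ρ // (f l, g l) = p})) ≃ ρ :=
    (Equiv.sigmaCongrRight fun p => (Fintype.equivFin {l : ρ // (f l, g l) = p}).symm).trans
      (Equiv.sigmaFiberEquiv fun l => (f l, g l))
  have he₁ : ∀ l, (f (e₁ l), g (e₁ l)) = l.1 := fun l =>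
    ((Fintype.equivFin {m : ρ // (f m, g m) = l.1}).symm l.2).2
  let e₂ := (Fintype.equivFin τ).symm
  let e : PairIndex (Fintype.card τ) (fun a b => Fintype.card {l : ρ // (f l, g l) = (a, b)}) ≃
    (τ ⊕ τ) ⊕ ρ := Equiv.sumCongr (Equiv.sumCongr e₂ e₂) e₁
  have he : ⇑(b.reindex e.symm) = b ∘ e := by ext l; simp
  refine ⟨_, _, b.reindex e.symm, ?_, ?_⟩
  · rw [he]
    convert hyb.reindex e using 1
    ext ((l | l) | l)
    · rfl
    · rfl
    · exact congrArg (fun p => (p.1 : ℕ)) (he₁ l).symm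
  · rw [he]
    convert hxb.reindex e using 1
    · ext ((l | l) | l) <;> rfl
    · ext ((l | l) | l)
      · rfl
      · rfl
      · exact congrArg (fun p => (p.2 : ℕ)) (he₁ l).symm

variable {t : ℕ} {c : Fin 4 → Fin 4 → ℕ} {y₂ y₁ x₂ x₁ : Submodule R M}

/-- Twisting by multiples of `π` does not change the reduction, so both chains are adapted to one
basis. In particular these dimensions do not distinguish a twisted block from two untwisted vectors
of labels `(3, 3)` and `(0, 0)`. -/
theorem finrank_reducedFlag_inf (hp : PairPosition π t c y₂ y₁ x₂ x₁) (i k : ℕ) :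
    finrank K ↥(reducedFlag K q j y₂ y₁ i ⊓ reducedFlag K q j x₂ x₁ k) = rankInf t c i k := by
  classical
  obtain ⟨b, hy, hx⟩ := hp
  obtain ⟨B, hB⟩ := h.exists_basis_reduction b
  rw [h.reducedFlag_eq_span hB rowLabel_le hy,
    h.reducedFlag_eq_span (fun l => (h.q_twist b l).trans (hB l)) colLabel_le hx, span_image_inf]
  have := finrank_span_image B (fun l => i ≤ rowLabel l ∧ k ≤ colLabel l)
  refine (Eq.trans ?_ this).trans ?_
  · rfl
  · exact card_filter_pairIndex _ _ _ (fun a b => i ≤ a ∧ k ≤ b) (fun l => Iff.rfl) (fun l => Iff.rfl)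
      fun l => Iff.rfl

theorem repr_reduction {κ : Type*} [Fintype κ] {b : Basis κ R M} {B : Basis κ K V}
    (hB : ∀ l, q (b l) = B l) (m : M) (l : κ) :
    B.repr (q m) l = algebraMap R K (b.repr m l) := by
  have : q m = ∑ l, algebraMap R K (b.repr m l) • B l := by
    conv_lhs => rw [← b.sum_repr m, map_sum]
    simp [hB]
  rw [this, B.repr_sum_self]

/-- This is the invariant that detects twisting: no twisted vector survives in the reduction of the
intersection. -/
theorem red_inf_eq_span {b : Basis (PairIndex t c) R M} (hy : FlagAdapted π b rowLabel y₂ y₁)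
    (hx : FlagAdapted π (twist π b) colLabel x₂ x₁) {B : Basis (PairIndex t c) K V}
    (hB : ∀ l, q (b l) = B l) : red K q (y₂ ⊓ x₂) =
      span K (B '' {l | l.elim (fun _ => False) fun p => p.1 = (3, 3)}) := by
  classical
  have hB' := fun l => (h.q_twist b l).trans (hB l)
  apply le_antisymm
  · intro v hv
    obtain ⟨m, ⟨hmy, hmx⟩, rfl⟩ := h.mem_red.1 hv
    have h1 : q m ∈ span K (B '' {l | 3 ≤ rowLabel l}) := by
      rw [← h.reducedFlag_eq_span hB rowLabel_le hy 3]
      exact h.mem_red.2 ⟨m, hmy, rfl⟩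
    have h2 : q m ∈ span K (B '' {l | 3 ≤ colLabel l}) := by
      rw [← h.reducedFlag_eq_span hB' colLabel_le hx 3]
      exact h.mem_red.2 ⟨m, hmx, rfl⟩
    rw [B.mem_span_image] at h1 h2 ⊢
    intro l hl
    have hl1 := h1 hl
    have hl2 := h2 hl
    rcases l with (l | l) | l
    · exfalso
      have hy0 : b.repr m (Sum.inl (Sum.inr l)) = 0 := by
        have : y₂ ≤ LinearMap.ker (b.coord (Sum.inl (Sum.inr l))) := by
          rw [hy.top_eq]
          refine sup_le (span_le.2 ?_) (span_le.2 ?_)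
          · rintro _ ⟨k, hk, rfl⟩
            have : k ≠ Sum.inl (Sum.inr l) := by
              rintro rfl
              exact absurd (show 3 ≤ 0 from hk) (by norm_num)
            simp [this]
          · rintro _ ⟨k, hk, rfl⟩
            have : k ≠ Sum.inl (Sum.inr l) := by
              rintro rfl
              exact absurd (show 1 ≤ 0 from hk) (by norm_num)
            simp [this]
        exact this hmy
      -- On `y₂` the second coordinate of a block is zero, while on `x₂` it is `π` times the first.
      -- On the intersection `π` therefore kills the first coordinate, so that coordinate reduces to
      -- zero.
      have hx0 : b.repr m (Sum.inl (Sum.inr l)) = π * b.repr m (Sum.inl (Sum.inl l)) := by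
        have : x₂ ≤ LinearMap.ker (b.coord (Sum.inl (Sum.inr l)) -
            π • b.coord (Sum.inl (Sum.inl l))) := by
          rw [hx.top_eq]
          refine sup_le (span_le.2 ?_) (span_le.2 ?_)
          · rintro _ ⟨(k | k) | k, hk, rfl⟩
            · simp [twist, Finsupp.single_apply]
            · exact absurd (show 3 ≤ 0 from hk) (by norm_num)
            · simp [twist]
          · rintro _ ⟨(k | k) | k, hk, rfl⟩
            · simp [twist, Finsupp.single_apply, h.mul_self]
            · exact absurd (show 1 ≤ 0 from hk) (by norm_num)
            · simp [twist]
        have := this hmx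
        rw [LinearMap.mem_ker, LinearMap.sub_apply, sub_eq_zero] at this
        exact this
      rw [hy0] at hx0
      refine Finsupp.mem_support_iff.1 hl ?_
      rw [h.repr_reduction hB]
      set r := b.repr m (Sum.inl (Sum.inl l))
      have hr : q (r • b (Sum.inl (Sum.inl l))) = 0 :=
        h.inj (by rw [h.comp, smul_smul, ← hx0, zero_smul, map_zero])
      rw [map_smul, hB, ← IsScalarTower.algebraMap_smul K] at hr
      exact (smul_eq_zero.1 hr).resolve_right (B.ne_zero _)
    · exact absurd (show 3 ≤ 0 from hl1) (by norm_num)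
    · have h3 : 3 ≤ (l.1.1 : ℕ) := hl1
      have h4 : 3 ≤ (l.1.2 : ℕ) := hl2
      show l.1 = (3, 3)
      ext
      · have := l.1.1.2; simp; omega
      · have := l.1.2.2; simp; omega
  · rw [span_le]
    rintro _ ⟨(l | l) | l, hl, rfl⟩
    · exact hl.elim
    · exact hl.elim
    · refine h.mem_red.2 ⟨b (Sum.inr l), ⟨?_, ?_⟩, hB _⟩
      · rw [hy.top_eq]
        refine mem_sup_left (subset_span ⟨_, ?_, rfl⟩)
        have hl' : l.1 = (3, 3) := hl
        show 3 ≤ (l.1.1 : ℕ)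
        rw [hl']; rfl
      · rw [hx.top_eq]
        refine mem_sup_left (subset_span ⟨Sum.inr l, ?_, rfl⟩)
        have hl' : l.1 = (3, 3) := hl
        show 3 ≤ (l.1.2 : ℕ)
        rw [hl']; rfl

theorem finrank_red_inf (hp : PairPosition π t c y₂ y₁ x₂ x₁) :
    finrank K ↥(red K q (y₂ ⊓ x₂)) = c 3 3 := by
  classical
  obtain ⟨b, hy, hx⟩ := hp
  obtain ⟨B, hB⟩ := h.exists_basis_reduction b
  rw [h.red_inf_eq_span hy hx hB]
  rw [finrank_span_image B, card_filter_pairIndex _ False False (fun a b => a = 3 ∧ b = 3)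
    (fun l => Iff.rfl) (fun l => Iff.rfl) (fun l => Prod.ext_iff)]
  simp [Fin.sum_univ_four]

theorem finrank_eq_of_pairPosition (hp : PairPosition π t c y₂ y₁ x₂ x₁) :
    finrank K V = t + t + ∑ a, ∑ b, c a b := by
  have := h.finrank_reducedFlag_inf hp 0 0
  have htop : reducedFlag K q j y₂ y₁ 0 ⊓ reducedFlag K q j x₂ x₁ 0 = ⊤ := inf_top_eq ⊤
  rw [htop, finrank_top] at this
  simpa [rankInf] using this

/-- The normal form of a pair of flags is unique. -/
theorem pairPosition_unique {t' : ℕ} {c' : Fin 4 → Fin 4 → ℕ}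
    (hp : PairPosition π t c y₂ y₁ x₂ x₁) (hp' : PairPosition π t' c' y₂ y₁ x₂ x₁) :
    t = t' ∧ c = c' := by
  have hr : ∀ i k, rankInf t c i k = rankInf t' c' i k := fun i k => by
    rw [← h.finrank_reducedFlag_inf hp, h.finrank_reducedFlag_inf hp']
  -- The intersection dimensions alone give `t + c 3 3`; this separates the two summands.
  have h33 : c 3 3 = c' 3 3 := by rw [← h.finrank_red_inf hp, h.finrank_red_inf hp']
  have e33 := hr 3 3
  have e32 := hr 3 2
  have e31 := hr 3 1
  have e30 := hr 3 0
  have e23 := hr 2 3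
  have e22 := hr 2 2
  have e21 := hr 2 1
  have e20 := hr 2 0
  have e13 := hr 1 3
  have e12 := hr 1 2
  have e11 := hr 1 1
  have e10 := hr 1 0
  have e03 := hr 0 3
  have e02 := hr 0 2
  have e01 := hr 0 1
  have e00 := hr 0 0
  simp [rankInf, Fin.sum_univ_four] at e33 e32 e31 e30 e23 e22 e21 e20 e13 e12 e11 e10 e03 e02 e01 e00
  refine ⟨by omega, ?_⟩
  ext a b
  fin_cases a <;> fin_cases b <;> simp <;> omega

end IsReduction

/-- Every normal form of the right size occurs. -/
theorem exists_of_pairPosition (π : R) {n t : ℕ} {c : Fin 4 → Fin 4 → ℕ} (b : Basis (Fin n) R M)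
    (hn : n = t + t + ∑ a, ∑ b, c a b) :
    ∃ y₂ y₁ x₂ x₁ : Submodule R M, PairPosition π t c y₂ y₁ x₂ x₁ := by
  have e : Fin n ≃ PairIndex t c := Fintype.equivOfCardEq (by
    simp [hn, Fintype.sum_prod_type])
  exact ⟨_, _, _, _, b.reindex e, ⟨rfl, rfl⟩, ⟨rfl, rfl⟩⟩

end PairPosition

/-! ### Semistandard tableaux and interlacing row contents. -/

section Tableaux

/-- Row lengths and row contents of a semistandard tableau satisfy the usual interlacing
inequalities. -/
theorem SemistandardYoungTableau.sum_card_le {μ : YoungDiagram} (T : SemistandardYoungTableau μ)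
    (i k : ℕ) : ∑ m ∈ Finset.range (k + 1),
      ((Finset.range (μ.rowLen (i + 1))).filter fun p => T (i + 1) p = m).card ≤
    ∑ m ∈ Finset.range k, ((Finset.range (μ.rowLen i)).filter fun p => T i p = m).card := by
  have key : ∀ i k, ∑ m ∈ Finset.range k,
      ((Finset.range (μ.rowLen i)).filter fun p => T i p = m).card =
      ((Finset.range (μ.rowLen i)).filter fun p => T i p < k).card := by
    intro i k
    rw [Finset.card_eq_sum_card_fiberwise (f := fun p => T i p) (t := Finset.range k)]
    · refine Finset.sum_congr rfl fun m hm => ?_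
      rw [Finset.filter_filter]
      congr 1
      refine Finset.filter_congr fun p _ => ?_
      have := Finset.mem_range.1 hm
      constructor
      · intro h; exact ⟨by omega, h⟩
      · exact fun h => h.2
    · intro p hp
      simpa using (Finset.mem_filter.1 hp).2
  rw [key, key]
  refine Finset.card_le_card fun p hp => ?_
  rw [Finset.mem_filter, Finset.mem_range] at hp ⊢
  -- Above every entry at most `k` in row `i + 1` stands an entry less than `k` in row `i`.
  have hmem : (i + 1, p) ∈ μ := YoungDiagram.mem_iff_lt_rowLen.2 hp.1
  have hlt := T.col_strict (Nat.lt_add_one i) hmem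
  exact ⟨lt_of_lt_of_le hp.1 (μ.rowLen_anti _ _ (Nat.le_succ i)), by omega⟩

/-- A matrix with interlacing partial row sums is the content matrix of a semistandard tableau. -/
theorem exists_semistandardYoungTableau (a : ℕ → ℕ → ℕ) {I J : ℕ} (hI : ∀ i k, I ≤ i → a i k = 0)
    (hJ : ∀ i k, J ≤ k → a i k = 0)
    (ha : ∀ i k, ∑ m ∈ Finset.range (k + 1), a (i + 1) m ≤ ∑ m ∈ Finset.range k, a i m) :
    ∃ (μ : YoungDiagram) (T : SemistandardYoungTableau μ), ∀ i k,
      ((Finset.range (μ.rowLen i)).filter fun p => T i p = k).card = a i k := by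
  classical
  set S : ℕ → ℕ → ℕ := fun i k => ∑ m ∈ Finset.range k, a i m with hS
  have hmono : ∀ i, Monotone (S i) := fun i =>
    monotone_nat_of_le_succ fun k => by simp [hS, Finset.sum_range_succ]
  have hanti : ∀ k, Antitone fun i => S i k := fun k =>
    antitone_nat_of_succ_le fun i => (hmono (i + 1) (Nat.le_succ k)).trans (ha i k)
  have hbound : ∀ i k, S i k ≤ S i J := by
    intro i k
    rcases le_total k J with h | h
    · exact hmono i h
    · refine (Finset.sum_subset (Finset.range_mono h) fun m _ hm => ?_).ge
      exact hJ i m (by simpa using hm)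
  have hzero : ∀ i, I ≤ i → S i J = 0 := fun i hi =>
    Finset.sum_eq_zero fun m _ => hI i m hi
  let μ : YoungDiagram :=
    { cells := (Finset.range I ×ˢ Finset.range (S 0 J)).filter fun c => c.2 < S c.1 J
      isLowerSet := by
        rintro ⟨i, p⟩ ⟨i', p'⟩ hle hmem
        simp only [Finset.coe_filter, Finset.mem_product, Finset.mem_range] at hmem ⊢
        have h1 : i' ≤ i := hle.1
        have h2 : p' ≤ p := hle.2
        have h3 := hanti J h1
        obtain ⟨⟨h4, h5⟩, h6⟩ := hmem
        simp only at h3 h4 h5 h6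
        exact ⟨⟨by simp; omega, by simp; omega⟩, by simp; omega⟩ }
  have hμ : ∀ i p, (i, p) ∈ μ ↔ p < S i J := by
    intro i p
    rw [← YoungDiagram.mem_cells]
    simp only [μ, Finset.mem_filter, Finset.mem_product, Finset.mem_range]
    refine ⟨fun h => h.2, fun h => ⟨⟨?_, lt_of_lt_of_le h (hanti J (Nat.zero_le i))⟩, h⟩⟩
    by_contra hlt
    rw [hzero i (by omega)] at h
    omega
  have hrow : ∀ i, μ.rowLen i = S i J := fun i =>
    eq_of_forall_lt_iff fun p => by rw [← YoungDiagram.mem_iff_lt_rowLen, hμ]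
  have hex : ∀ {i p}, p < S i J → ∃ k, p < S i (k + 1) := fun {i p} h =>
    ⟨J, lt_of_lt_of_le h (hmono i (Nat.le_succ J))⟩
  let T : SemistandardYoungTableau μ :=
    -- Letter `k` fills the boxes `S i k ≤ p < S i (k + 1)` of row `i`; the value `0` outside the
    -- diagram is the required default.
    { entry := fun i p => if h : p < S i J then Nat.find (hex h) else 0
      row_weak' := by
        intro i p p' hp hmem
        have h' := (hμ _ _).1 hmem
        have h := hp.trans h'
        rw [dif_pos h, dif_pos h']
        exact Nat.find_min' _ (hp.trans (Nat.find_spec (hex h')))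
      col_strict' := by
        intro i i' p hi hmem
        have h' := (hμ _ _).1 hmem
        have h := lt_of_lt_of_le h' (hanti J hi.le)
        rw [dif_pos h, dif_pos h']
        have h1 := Nat.find_spec (hex h')
        set k := Nat.find (hex h')
        obtain ⟨i'', rfl⟩ : ∃ i'', i' = i'' + 1 := ⟨i' - 1, by omega⟩
        -- Interlacing shifts the letter bound by one, so the entry above is strictly smaller; `p <
        -- S i k` also forces `k` to be positive.
        have h2 : p < S i k := by
          have h3 : S (i'' + 1) (k + 1) ≤ S i'' k := ha i'' k
          exact h1.trans_le (h3.trans (hanti k (show i ≤ i'' by omega)))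
        obtain ⟨k', hk'⟩ : ∃ k', k = k' + 1 := by
          refine ⟨k - 1, ?_⟩
          have : k ≠ 0 := by
            intro h0
            rw [h0] at h2
            simp [hS] at h2
          omega
        rw [hk'] at h2 ⊢
        exact Nat.lt_succ_of_le (Nat.find_min' _ h2)
      zeros' := by
        intro i p hmem
        rw [hμ] at hmem
        exact dif_neg hmem }
  refine ⟨μ, T, fun i k => ?_⟩
  have hT : ∀ p, p < S i J → (T i p = k ↔ S i k ≤ p ∧ p < S i (k + 1)) := by
    intro p hp
    have : T i p = Nat.find (hex hp) := dif_pos hp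
    rw [this, Nat.find_eq_iff]
    constructor
    · rintro ⟨h1, h2⟩
      refine ⟨?_, h1⟩
      rcases Nat.eq_zero_or_pos k with rfl | hk
      · simp [hS]
      · have := h2 (k - 1) (by omega)
        rw [Nat.sub_add_cancel hk] at this
        omega
    · rintro ⟨h1, h2⟩
      refine ⟨h2, fun m hm => ?_⟩
      have := hmono i (show m + 1 ≤ k by omega)
      omega
  have : ((Finset.range (μ.rowLen i)).filter fun p => T i p = k) =
      Finset.Ico (S i k) (S i (k + 1)) := by
    ext p
    rw [Finset.mem_filter, Finset.mem_range, hrow, Finset.mem_Ico]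
    constructor
    · rintro ⟨h1, h2⟩
      exact (hT p h1).1 h2
    · intro h
      have h1 := lt_of_lt_of_le h.2 (hbound i (k + 1))
      exact ⟨h1, (hT p h1).2 h⟩
  rw [this, Nat.card_Ico]
  simp [hS, Finset.sum_range_succ]

variable {R : Type*} [CommRing R] {M : Type*} [AddCommGroup M] [Module R M]

theorem isSemistandardPosition_iff (F G : ℕ → Submodule R M) (a : ℕ → ℕ → ℕ)
    (hFG : ∀ i k, intersectionMatrix F G i k = a i k) {I J : ℕ} (hI : ∀ i k, I ≤ i → a i k = 0)
    (hJ : ∀ i k, J ≤ k → a i k = 0) :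
    IsSemistandardPosition F G ↔
      ∀ i k, ∑ m ∈ Finset.range (k + 1), a (i + 1) m ≤ ∑ m ∈ Finset.range k, a i m := by
  constructor
  · rintro ⟨μ, T, hT⟩ i k
    have h : ∀ i k, ((Finset.range (μ.rowLen i)).filter fun p => T i p = k).card = a i k :=
      fun i k => by exact_mod_cast (hT i k).trans (hFG i k)
    simp only [← h]
    exact SemistandardYoungTableau.sum_card_le T i k
  · intro ha
    obtain ⟨μ, T, hT⟩ := exists_semistandardYoungTableau a hI hJ ha
    exact ⟨μ, T, fun i k => by rw [hT, hFG]⟩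

end Tableaux

/-! ### Intersection matrices of coordinate flags after passing to a quotient. -/

section IntersectionMatrix

theorem length_quotient_submoduleOf {R M : Type*} [CommRing R] [AddCommGroup M] [Module R M]
    {N' N : Submodule R M} (hle : N' ≤ N) {a b c : ℕ} (hN : Module.length R N = a)
    (hN' : Module.length R N' = b) (habc : a = b + c) :
    Module.length R (↥N ⧸ N'.submoduleOf N) = c := by
  have h1 := Module.length_eq_add_of_exact (N'.submoduleOf N).subtype (N'.submoduleOf N).mkQ
    (Submodule.subtype_injective _) (Submodule.mkQ_surjective _)
    (LinearMap.exact_subtype_mkQ _)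
  rw [(Submodule.submoduleOfEquivOfLe hle).length_eq, hN, hN', habc, Nat.cast_add] at h1
  exact (WithTop.add_left_cancel (ENat.natCast_ne_top b) h1).symm

theorem intersectionMatrix_eq {R M : Type*} [CommRing R] [AddCommGroup M] [Module R M]
    {F G : ℕ → Submodule R M} {i k : ℕ} {N N' : Submodule R M} (hFG : F i ⊓ G k = N)
    (hFG' : F i ⊓ G (k + 1) ⊔ F (i + 1) ⊓ G k = N') :
    intersectionMatrix F G i k = Module.length R (↥N ⧸ N'.submoduleOf N) := by
  subst hFG hFG'
  rfl

variable {R K M V W : Type*} [CommRing R] [Field K] [Algebra R K] [AddCommGroup M] [Module R M]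
  [AddCommGroup V] [Module K V] [Module R V] [IsScalarTower R K V] [AddCommGroup W] [Module R W]

section Coordinates

variable {κ : Type*} (B : Basis κ K V) (ψ : V →ₗ[R] W) (L : Set κ)

/-- The image of a coordinate subspace. -/
def coordMap (s : Set κ) : Submodule R W := ((span K (B '' s)).restrictScalars R).map ψ

variable {B ψ L} (hker : ∀ v, ψ v = 0 ↔ v ∈ span K (B '' Lᶜ))
include hker

/-- The kernel of `ψ` is the coordinate subspace complementary to that of `L`, so `ψ` is injective
on the coordinate subspace of `L`. -/
theorem eq_of_coordMap_eq {u v : V} (hu : u ∈ span K (B '' L)) (hv : v ∈ span K (B '' L))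
    (huv : ψ u = ψ v) : u = v := by
  have h1 : u - v ∈ span K (B '' Lᶜ) := by rw [← hker, map_sub, huv, sub_self]
  have h2 : u - v ∈ span K (B '' L) ⊓ span K (B '' Lᶜ) := ⟨sub_mem hu hv, h1⟩
  rw [span_image_inf, Set.inter_compl_self] at h2
  rw [← sub_eq_zero]
  simpa using h2

theorem coordMap_inter (s : Set κ) : coordMap B ψ s = coordMap B ψ (s ∩ L) := by
  apply le_antisymm
  · rintro _ ⟨v, hv, rfl⟩
    have hv' : v ∈ span K (B '' (s ∩ L)) ⊔ span K (B '' Lᶜ) := by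
      rw [← span_union, ← Set.image_union]
      refine span_mono (Set.image_mono ?_) hv
      intro l hl
      by_cases h : l ∈ L
      · exact Or.inl ⟨hl, h⟩
      · exact Or.inr h
    obtain ⟨u, hu, w, hw, rfl⟩ := mem_sup.1 hv'
    exact ⟨u, hu, by rw [map_add, (hker w).2 hw, add_zero]⟩
  · exact map_mono (span_mono (Set.image_mono Set.inter_subset_left))

theorem coordMap_inf (s t : Set κ) : coordMap B ψ s ⊓ coordMap B ψ t = coordMap B ψ (s ∩ t) := by
  apply le_antisymm
  · rw [coordMap_inter hker s, coordMap_inter hker t]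
    rintro _ ⟨⟨u, hu, rfl⟩, v, hv, huv⟩
    have hu' : u ∈ span K (B '' (s ∩ L)) := hu
    have hv' : v ∈ span K (B '' (t ∩ L)) := hv
    have : v = u := eq_of_coordMap_eq hker
      (span_mono (Set.image_mono Set.inter_subset_right) hv')
      (span_mono (Set.image_mono Set.inter_subset_right) hu') huv
    subst this
    refine ⟨v, ?_, rfl⟩
    have h1 : v ∈ span K (B '' (s ∩ L)) ⊓ span K (B '' (t ∩ L)) := ⟨hu', hv'⟩
    rw [span_image_inf] at h1
    refine span_mono (Set.image_mono ?_) h1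
    exact fun l hl => ⟨hl.1.1, hl.2.1⟩
  · exact le_inf (map_mono (span_mono (Set.image_mono Set.inter_subset_left)))
      (map_mono (span_mono (Set.image_mono Set.inter_subset_right)))

omit hker in
theorem coordMap_sup (s t : Set κ) : coordMap B ψ s ⊔ coordMap B ψ t = coordMap B ψ (s ∪ t) := by
  apply le_antisymm
  · exact sup_le (map_mono (span_mono (Set.image_mono Set.subset_union_left)))
      (map_mono (span_mono (Set.image_mono Set.subset_union_right)))
  · rintro _ ⟨v, hv, rfl⟩
    have hv' : v ∈ span K (B '' s) ⊔ span K (B '' t) := by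
      rw [← span_union, ← Set.image_union]; exact hv
    obtain ⟨u, hu, w, hw, rfl⟩ := mem_sup.1 hv'
    rw [map_add]
    exact add_mem (mem_sup_left ⟨u, hu, rfl⟩) (mem_sup_right ⟨w, hw, rfl⟩)

/-- Injectivity transports the length to a coordinate subspace, where length over `R` is dimension
over `K` because `R → K` is surjective. -/
theorem length_coordMap [Fintype κ] (hsurj : Function.Surjective (algebraMap R K))
    (P : κ → Prop) [DecidablePred P] (hP : {l | P l} ⊆ L) :
    Module.length R (coordMap B ψ {l | P l}) = (Finset.univ.filter P).card := by
  have : FiniteDimensional K V := B.finiteDimensional_of_finite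
  set U := (span K (B '' {l | P l})).restrictScalars R with hU
  have hinj : Function.Injective (ψ.domRestrict U) := by
    intro u v huv
    exact Subtype.ext (eq_of_coordMap_eq hker (span_mono (Set.image_mono hP) u.2)
      (span_mono (Set.image_mono hP) v.2) huv)
  have e := LinearEquiv.ofInjective _ hinj
  rw [LinearMap.range_domRestrict] at e
  have h1 : Module.length R (coordMap B ψ {l | P l}) = Module.length R U := e.length_eq.symm
  rw [h1]
  have h2 : Module.length R U = Module.length K U := Module.length_eq_of_surjective hsurj
  rw [h2, (Submodule.restrictScalarsEquiv R K V (span K (B '' {l | P l}))).length_eq,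
    Module.length_eq_finrank, finrank_span_image]

/-- The intersection matrix of two flags of images of coordinate subspaces. -/
theorem intersectionMatrix_coordMap [Fintype κ] (hsurj : Function.Surjective (algebraMap R K))
    (r s : κ → ℕ) (D : κ → Prop) [DecidablePred D] (hD : L = {l | D l}) (i k : ℕ) :
    intersectionMatrix (fun i => coordMap B ψ {l | i ≤ r l}) (fun k => coordMap B ψ {l | k ≤ s l})
      i k = (Finset.univ.filter fun l => (r l = i ∧ s l = k) ∧ D l).card := by
  classical
  subst hD
  rw [intersectionMatrix_eq ((coordMap_inf hker _ _).trans (coordMap_inter hker _))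
    (by rw [coordMap_inf hker, coordMap_inf hker, coordMap_sup, coordMap_inter hker])]
  refine length_quotient_submoduleOf ?_
    (length_coordMap hker hsurj (fun l => (i ≤ r l ∧ k ≤ s l) ∧ D l) fun l hl => hl.2)
    (length_coordMap hker hsurj (fun l => (i ≤ r l ∧ k + 1 ≤ s l ∨ i + 1 ≤ r l ∧ k ≤ s l) ∧ D l)
      fun l hl => hl.2) ?_
  · refine map_mono (span_mono (Set.image_mono ?_))
    rintro l ⟨⟨h1, h2⟩ | ⟨h1, h2⟩, h3⟩
    · exact ⟨⟨h1, le_trans (Nat.le_succ k) h2⟩, h3⟩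
    · exact ⟨⟨le_trans (Nat.le_succ i) h1, h2⟩, h3⟩
  · rw [← Finset.card_union_of_disjoint]
    · congr 1
      ext l
      simp only [Finset.mem_union, Finset.mem_filter, Finset.mem_univ, true_and]
      by_cases hd : D l <;> simp only [hd, and_true, and_false, or_false]
      omega
    · rw [Finset.disjoint_filter]
      intro l _ h1 h2
      omega

end Coordinates

end IntersectionMatrix

/-! ### Permissible embeddings in terms of the position. -/

section PermissiblePosition

/-- The interlacing inequalities for the rows `0`, `1`, `2` of `c`. -/
def Interlacing (c : Fin 4 → Fin 4 → ℕ) : Prop :=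
  (c 1 0 = 0 ∧ c 1 1 ≤ c 0 0 ∧ c 1 1 + c 1 2 ≤ c 0 0 + c 0 1 ∧
    c 1 1 + c 1 2 + c 1 3 ≤ c 0 0 + c 0 1 + c 0 2) ∧
  c 2 0 = 0 ∧ c 2 1 = 0 ∧ c 2 2 ≤ c 1 1 ∧ c 2 2 + c 2 3 ≤ c 1 1 + c 1 2

/-- The entry of `c` in one of the rows `0`, `1`, `2`, and zero elsewhere. -/
def cellCount (c : Fin 4 → Fin 4 → ℕ) (i k : ℕ) : ℕ :=
  ∑ a : Fin 4, ∑ b : Fin 4, if ((a : ℕ) = i ∧ (b : ℕ) = k) ∧ (a : ℕ) < 3 then c a b else 0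

theorem cellCount_of_le_row (c : Fin 4 → Fin 4 → ℕ) (i k : ℕ) (hi : 3 ≤ i) :
    cellCount c i k = 0 :=
  Finset.sum_eq_zero fun a _ => Finset.sum_eq_zero fun b _ => if_neg (by omega)

theorem cellCount_of_le_col (c : Fin 4 → Fin 4 → ℕ) (i k : ℕ) (hk : 4 ≤ k) :
    cellCount c i k = 0 :=
  Finset.sum_eq_zero fun a _ => Finset.sum_eq_zero fun b _ => if_neg (by omega)

theorem interlacing_iff (c : Fin 4 → Fin 4 → ℕ) :
    Interlacing c ↔ ∀ i k, ∑ m ∈ Finset.range (k + 1), cellCount c (i + 1) m ≤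
      ∑ m ∈ Finset.range k, cellCount c i m := by
  have hrow : ∀ i m : ℕ, ∀ (hi : i < 3) (hm : m < 4), cellCount c i m =
      c ⟨i, by omega⟩ ⟨m, hm⟩ := by
    intro i m hi hm
    rw [cellCount, Finset.sum_eq_single ⟨i, by omega⟩, Finset.sum_eq_single ⟨m, hm⟩]
    · simp [hi]
    · intro b _ hb
      exact if_neg fun h => hb (Fin.ext h.1.2)
    · simp
    · intro a _ ha
      exact Finset.sum_eq_zero fun b _ => if_neg fun h => ha (Fin.ext h.1.1)
    · simp
  have h00 : cellCount c 0 0 = c 0 0 := hrow 0 0 (by norm_num) (by norm_num)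
  have h01 : cellCount c 0 1 = c 0 1 := hrow 0 1 (by norm_num) (by norm_num)
  have h02 : cellCount c 0 2 = c 0 2 := hrow 0 2 (by norm_num) (by norm_num)
  have h03 : cellCount c 0 3 = c 0 3 := hrow 0 3 (by norm_num) (by norm_num)
  have h10 : cellCount c 1 0 = c 1 0 := hrow 1 0 (by norm_num) (by norm_num)
  have h11 : cellCount c 1 1 = c 1 1 := hrow 1 1 (by norm_num) (by norm_num)
  have h12 : cellCount c 1 2 = c 1 2 := hrow 1 2 (by norm_num) (by norm_num)
  have h13 : cellCount c 1 3 = c 1 3 := hrow 1 3 (by norm_num) (by norm_num)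
  have h20 : cellCount c 2 0 = c 2 0 := hrow 2 0 (by norm_num) (by norm_num)
  have h21 : cellCount c 2 1 = c 2 1 := hrow 2 1 (by norm_num) (by norm_num)
  have h22 : cellCount c 2 2 = c 2 2 := hrow 2 2 (by norm_num) (by norm_num)
  have h23 : cellCount c 2 3 = c 2 3 := hrow 2 3 (by norm_num) (by norm_num)
  constructor
  · rintro ⟨⟨a1, a2, a3, a4⟩, a5, a6, a7, a8⟩ i k
    rcases lt_or_ge i 2 with hi | hi
    · rcases lt_or_ge k 4 with hk | hk
      · interval_cases i <;> interval_cases k <;>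
          simp only [Finset.sum_range_succ, Finset.sum_range_zero, zero_add, h00, h01, h02, h10,
            h11, h12, h13, h20, h21, h22, h23, Nat.reduceAdd] <;> omega
      · have htail : ∀ i l, 4 ≤ l → ∑ m ∈ Finset.range l, cellCount c i m =
            ∑ m ∈ Finset.range 4, cellCount c i m := by
          intro i l hl
          refine (Finset.sum_subset (Finset.range_mono hl) fun m _ hm => ?_).symm
          exact cellCount_of_le_col c i m (by simpa using hm)
        rw [htail _ _ hk, htail _ _ (by omega)]
        interval_cases i <;>
          simp only [Finset.sum_range_succ, Finset.sum_range_zero, zero_add, h00, h01, h02, h03, h10,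
            h11, h12, h13, h20, h21, h22, h23, Nat.reduceAdd] <;> omega
    · rw [Finset.sum_eq_zero fun m _ => cellCount_of_le_row c (i + 1) m (by omega)]
      exact Nat.zero_le _
  · intro h
    have b1 := h 0 0
    have b2 := h 0 1
    have b3 := h 0 2
    have b4 := h 0 3
    have b5 := h 1 0
    have b6 := h 1 1
    have b7 := h 1 2
    have b8 := h 1 3
    simp only [Finset.sum_range_succ, Finset.sum_range_zero, zero_add, h00, h01, h02, h10,
      h11, h12, h13, h20, h21, h22, h23, Nat.reduceAdd] at b1 b2 b3 b4 b5 b6 b7 b8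
    unfold Interlacing
    omega

variable {R K : Type*} [CommRing R] [Field K] [Algebra R K] {π : R} {n : ℕ}
  {q : (Fin n → R) →ₗ[R] (Fin n → K)} {j : (Fin n → K) →ₗ[R] (Fin n → R)}

namespace IsReduction

variable (h : IsReduction K π q j)
include h

theorem torsionFlag_eq {y : TwoFlag R n} (hy : IsPreflag π y.top y.bot) (i : ℕ) :
    torsionFlag π y i = ((reducedFlag K q j y.top y.bot i).restrictScalars R).map j := by
  have htor : ∀ N : Submodule R (Fin n → R),
      piTorsion π N = ((tor K j N).restrictScalars R).map j := by
    intro N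
    ext m
    constructor
    · rintro ⟨h1, h2⟩
      obtain ⟨v, rfl⟩ := h.exists_j_of_smul_eq_zero (show π • m = 0 from h2)
      exact ⟨v, h.mem_tor.2 h1, rfl⟩
    · rintro ⟨v, hv, rfl⟩
      exact ⟨h.mem_tor.1 hv, h.smul_j v⟩
  match i with
  | 0 =>
    rw [torsionFlag, htor]
    congr 2
    exact eq_top_iff.2 fun v _ => h.mem_tor.2 trivial
  | 1 => exact htor _
  | 2 =>
    have : piTorsion π y.bot = y.bot := inf_eq_left.2 fun m hm => hy.smul_eq_zero m hm
    exact this.symm.trans (htor _)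
  | 3 =>
    ext m
    constructor
    · rintro ⟨m, hm, rfl⟩
      exact ⟨q m, h.mem_red.2 ⟨m, hm, rfl⟩, h.comp m⟩
    · rintro ⟨v, hv, rfl⟩
      obtain ⟨m, hm, rfl⟩ := h.mem_red.1 hv
      exact ⟨m, hm, (h.comp m).symm⟩
  | i + 4 =>
    simp [torsionFlag, reducedFlag]

variable {t : ℕ} {c : Fin 4 → Fin 4 → ℕ} {y x : TwoFlag R n}

/-- Dividing by `πy₂` kills exactly the basis vectors of row label `3`, so the intersection matrix
consists of the rows `0`, `1`, `2` of `c`. -/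
theorem isSemistandardPosition_torsionFlag_iff (hp : PairPosition π 0 c y.top y.bot x.top x.bot) :
    IsSemistandardPosition (fun i => (torsionFlag π y i).map (piMul π y.top).mkQ)
      (fun k => (torsionFlag π x k).map (piMul π y.top).mkQ) ↔ Interlacing c := by
  obtain ⟨b, hy, hx⟩ := hp
  have hypre := h.isPreflag_of_flagAdapted hy
  have hxpre := h.isPreflag_of_flagAdapted hx
  obtain ⟨B, hB⟩ := h.exists_basis_reduction b
  have hB' := fun l => (h.q_twist b l).trans (hB l)
  set ψ : (Fin n → K) →ₗ[R] ((Fin n → R) ⧸ piMul π y.top) := (piMul π y.top).mkQ ∘ₗ j with hψ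
  have hflag : ∀ {z : TwoFlag R n}, IsPreflag π z.top z.bot → ∀ i,
      (torsionFlag π z i).map (piMul π y.top).mkQ =
        ((reducedFlag K q j z.top z.bot i).restrictScalars R).map ψ := by
    intro z hz i
    rw [h.torsionFlag_eq hz, hψ, Submodule.map_comp]
  have hF : (fun i => (torsionFlag π y i).map (piMul π y.top).mkQ) =
      fun i => coordMap B ψ {l | i ≤ rowLabel l} := by
    funext i
    rw [hflag hypre, h.reducedFlag_eq_span hB rowLabel_le hy]
    rfl
  have hG : (fun i => (torsionFlag π x i).map (piMul π y.top).mkQ) =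
      fun i => coordMap B ψ {l | i ≤ colLabel l} := by
    funext i
    rw [hflag hxpre, h.reducedFlag_eq_span hB' colLabel_le hx]
    rfl
  have hker : ∀ v, ψ v = 0 ↔ v ∈ span K (B '' {l : PairIndex 0 c | rowLabel l < 3}ᶜ) := by
    intro v
    have h1 : {l : PairIndex 0 c | rowLabel l < 3}ᶜ = {l | 3 ≤ rowLabel l} := by
      ext l
      exact not_lt (a := rowLabel l)
    rw [h1, ← h.reducedFlag_eq_span hB rowLabel_le hy, hψ, LinearMap.comp_apply, mkQ_apply,
      Submodule.Quotient.mk_eq_zero]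
    have h2 := h.torsionFlag_eq hypre 3
    have h3 : piMul π y.top = torsionFlag π y 3 := rfl
    rw [h3, h2]
    exact ⟨fun ⟨u, hu, huv⟩ => h.inj huv ▸ hu, fun hv => ⟨v, hv, rfl⟩⟩
  rw [hF, hG, interlacing_iff]
  refine isSemistandardPosition_iff _ _ (cellCount c) (fun i k => ?_) (cellCount_of_le_row c)
    (cellCount_of_le_col c)
  rw [intersectionMatrix_coordMap hker h.surj_algebraMap _ _ (fun l => rowLabel l < 3) rfl]
  rw [card_filter_pairIndex _ False False (fun a b => ((a : ℕ) = i ∧ (b : ℕ) = k) ∧ (a : ℕ) < 3)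
    (fun l => l.elim0) (fun l => l.elim0) (fun l => Iff.rfl)]
  simp [cellCount]

omit [Field K] [Algebra R K] h in
theorem le_of_pairPosition (hp : PairPosition π 0 c y.top y.bot x.top x.bot)
    (hc : c 1 0 = 0 ∧ c 2 0 = 0 ∧ c 2 1 = 0 ∧ c 3 0 = 0 ∧ c 3 1 = 0 ∧ c 3 2 = 0) :
    y.top ≤ x.top ∧ y.bot ≤ x.bot := by
  obtain ⟨b, hy, hx⟩ := hp
  have htw : twist π b = b := by
    ext ((l | l) | l)
    · exact l.elim0
    · exact l.elim0
    · rfl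
  rw [htw] at hx
  have hlab : ∀ l : PairIndex 0 c, rowLabel l ≤ colLabel l := by
    rintro ((l | l) | ⟨⟨i, k⟩, z⟩)
    · exact l.elim0
    · exact l.elim0
    · have hz : 0 < c i k := z.pos
      change (i : ℕ) ≤ k
      by_contra hlt
      obtain ⟨h10, h20, h21, h30, h31, h32⟩ := hc
      fin_cases i <;> fin_cases k <;> simp at hlt hz <;> omega
  have hmono : ∀ (f : PairIndex 0 c → Fin n → R) (i : ℕ),
      span R (f '' {l | i ≤ rowLabel l}) ≤ span R (f '' {l | i ≤ colLabel l}) :=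
    fun f i => span_mono (Set.image_mono fun l hl => le_trans hl (hlab l))
  constructor
  · rw [hy.top_eq, hx.top_eq]
    exact sup_le_sup (hmono _ _) (hmono _ _)
  · rw [hy.bot_eq, hx.bot_eq]
    exact hmono _ _

/-- If `y₂ ⊆ x₂`, the reduction of `y₂ ∩ x₂` is that of `y₂`, so `c 3 3` equals `t` plus the whole
sum of row `3`, which forces `t` and the other entries of that row to vanish. Conversely, the zeros
contained in interlacing make every row label at most the column label, which gives the inclusions.
-/
theorem embedsPermissibly_iff (hp : PairPosition π t c y.top y.bot x.top x.bot) :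
    EmbedsPermissibly π y x ↔
      t = 0 ∧ c 3 0 = 0 ∧ c 3 1 = 0 ∧ c 3 2 = 0 ∧ Interlacing c := by
  constructor
  · rintro ⟨htop, hbot, hpos⟩
    have h1 := h.finrank_red_inf hp
    rw [inf_eq_left.2 htop] at h1
    have h2 := h.finrank_reducedFlag_inf hp 3 0
    have h3 : reducedFlag K q j y.top y.bot 3 ⊓ reducedFlag K q j x.top x.bot 0 =
        red K q y.top := inf_top_eq _
    rw [h3, h1] at h2
    simp [rankInf, Fin.sum_univ_four] at h2
    obtain rfl : t = 0 := by omega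
    exact ⟨rfl, by omega, by omega, by omega,
      (h.isSemistandardPosition_torsionFlag_iff hp).1 hpos⟩
  · rintro ⟨rfl, h30, h31, h32, hint⟩
    obtain ⟨⟨h10, -⟩, h20, h21, -⟩ := id hint
    have hle := le_of_pairPosition hp ⟨h10, h20, h21, h30, h31, h32⟩
    exact ⟨hle.1, hle.2, (h.isSemistandardPosition_torsionFlag_iff hp).2 hint⟩

end IsReduction

end PermissiblePosition

/-! ### The action of `GL_n` as the action of linear automorphisms. -/

section Orbits

variable {R : Type*} [CommRing R] {n : ℕ}

/-- The image of a flag under an automorphism. -/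
def TwoFlag.map (φ : (Fin n → R) ≃ₗ[R] (Fin n → R)) (x : TwoFlag R n) : TwoFlag R n :=
  ⟨x.top.map (φ : (Fin n → R) →ₗ[R] (Fin n → R)), x.bot.map (φ : (Fin n → R) →ₗ[R] (Fin n → R)),
    map_mono x.bot_le_top⟩

theorem mem_orbit_iff (p p' : TwoFlag R n × TwoFlag R n) :
    p' ∈ MulAction.orbit (Matrix.GeneralLinearGroup (Fin n) R) p ↔
      ∃ φ : (Fin n → R) ≃ₗ[R] (Fin n → R), p' = (p.1.map φ, p.2.map φ) := by
  constructor
  · rintro ⟨g, rfl⟩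
    refine ⟨LinearEquiv.ofLinearMap (Matrix.mulVecLin (g : Matrix (Fin n) (Fin n) R))
      (Matrix.mulVecLin ((g⁻¹ : Matrix.GeneralLinearGroup (Fin n) R) : Matrix (Fin n) (Fin n) R))
      ?_ ?_, ?_⟩
    · rw [← Matrix.mulVecLin_mul, ← Units.val_mul, mul_inv_cancel, Units.val_one,
        Matrix.mulVecLin_one]
    · rw [← Matrix.mulVecLin_mul, ← Units.val_mul, inv_mul_cancel, Units.val_one,
        Matrix.mulVecLin_one]
    · rfl
  · rintro ⟨φ, rfl⟩
    let g : Matrix.GeneralLinearGroup (Fin n) R :=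
      ⟨LinearMap.toMatrix' (φ : (Fin n → R) →ₗ[R] (Fin n → R)),
        LinearMap.toMatrix' (φ.symm : (Fin n → R) →ₗ[R] (Fin n → R)),
        by rw [← LinearMap.toMatrix'_comp]; simp, by rw [← LinearMap.toMatrix'_comp]; simp⟩
    have hg : Matrix.mulVecLin (g : Matrix (Fin n) (Fin n) R) =
        (φ : (Fin n → R) →ₗ[R] (Fin n → R)) := by
      rw [← Matrix.toLin'_apply', Matrix.toLin'_toMatrix']
    have hsmul : ∀ x : TwoFlag R n, g • x = x.map φ := by
      intro x
      apply TwoFlag.ext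
      · change x.top.map (Matrix.mulVecLin (g : Matrix (Fin n) (Fin n) R)) = _
        rw [hg]; rfl
      · change x.bot.map (Matrix.mulVecLin (g : Matrix (Fin n) (Fin n) R)) = _
        rw [hg]; rfl
    exact ⟨g, Prod.ext (hsmul p.1) (hsmul p.2)⟩

end Orbits

/-! ### Types of finite modules detected by counting. -/

section Types

variable {R : Type*} [CommRing R] {π : R}

/-- The properties of the uniformizer of a quotient of length two of a discrete valuation ring. -/
structure IsSquareZeroUniformizer (π : R) : Prop where
  mul_self : π * π = 0
  dvd_of_mul_eq_zero : ∀ r, π * r = 0 → π ∣ r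
  isMaximal : (Ideal.span {π}).IsMaximal

/-- Multiplication by `π`, as a map from the residue field. -/
noncomputable def mulLift (hπ : π * π = 0) : (R ⧸ Ideal.span {π}) →ₗ[R] R :=
  Submodule.liftQ (Ideal.span {π}) (LinearMap.lsmul R R π) (by
    rw [Ideal.span_le]
    rintro _ rfl
    exact hπ)

theorem mulLift_mk (hπ : π * π = 0) (r : R) :
    mulLift hπ (Ideal.Quotient.mk (Ideal.span {π}) r) = π * r := rfl

attribute [local instance] Ideal.Quotient.field

/-- Instantiates the abstract setting with the coordinatewise residue map and the coordinatewise map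
induced by multiplication by `π`. -/
theorem IsSquareZeroUniformizer.isReduction (h : IsSquareZeroUniformizer π)
    [(Ideal.span {π}).IsMaximal] (n : ℕ) :
    IsReduction (R ⧸ Ideal.span {π}) π
      ((Algebra.linearMap R (R ⧸ Ideal.span {π})).compLeft (Fin n))
      ((mulLift h.mul_self).compLeft (Fin n)) where
  mul_self := h.mul_self
  surj_algebraMap := Ideal.Quotient.mk_surjective
  algebraMap_eq_zero r := by
    rw [Ideal.Quotient.algebraMap_eq, Ideal.Quotient.eq_zero_iff_dvd]
  surj v := by
    choose m hm using fun i => Ideal.Quotient.mk_surjective (v i)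
    exact ⟨m, funext hm⟩
  inj := by
    rw [← LinearMap.ker_eq_bot, LinearMap.ker_eq_bot']
    intro v hv
    funext i
    obtain ⟨r, hr⟩ := Ideal.Quotient.mk_surjective (v i)
    have h1 : mulLift h.mul_self (v i) = 0 := congrFun hv i
    rw [← hr, mulLift_mk] at h1
    rw [← hr]
    exact (Ideal.Quotient.eq_zero_iff_dvd _ _).2 (h.dvd_of_mul_eq_zero r h1)
  comp m := rfl
  ker m hm := by
    have h1 : ∀ i, ∃ r, m i = π * r := fun i =>
      (Ideal.Quotient.eq_zero_iff_dvd _ _).1 (congrFun hm i)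
    choose r hr using h1
    exact ⟨fun i => Ideal.Quotient.mk _ (r i), funext fun i => (hr i).symm⟩

variable [Finite R]

theorem finite_residue : Finite (R ⧸ Ideal.span {π}) :=
  Finite.of_surjective _ Ideal.Quotient.mk_surjective

theorem card_ker_mul (h : IsSquareZeroUniformizer π) :
    Nat.card {r : R // π * r = 0} = Nat.card (R ⧸ Ideal.span {π}) := by
  have hmem : ∀ v, π * mulLift h.mul_self v = 0 := by
    intro v
    obtain ⟨r, rfl⟩ := Ideal.Quotient.mk_surjective v
    rw [mulLift_mk, ← mul_assoc, h.mul_self, zero_mul]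
  refine (Nat.card_congr (Equiv.ofBijective (fun v => ⟨mulLift h.mul_self v, hmem v⟩)
    ⟨?_, ?_⟩)).symm
  · intro u v huv
    obtain ⟨r, rfl⟩ := Ideal.Quotient.mk_surjective u
    obtain ⟨s, rfl⟩ := Ideal.Quotient.mk_surjective v
    have h1 : π * r = π * s := congrArg Subtype.val huv
    rw [Ideal.Quotient.eq, Ideal.mem_span_singleton]
    exact h.dvd_of_mul_eq_zero _ (by rw [mul_sub, h1, sub_self])
  · rintro ⟨r, hr⟩
    obtain ⟨s, rfl⟩ := h.dvd_of_mul_eq_zero r hr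
    exact ⟨Ideal.Quotient.mk _ s, Subtype.ext (mulLift_mk _ s)⟩

theorem card_eq_sq (h : IsSquareZeroUniformizer π) :
    Nat.card R = Nat.card (R ⧸ Ideal.span {π}) * Nat.card (R ⧸ Ideal.span {π}) := by
  rw [Submodule.card_eq_card_quotient_mul_card (Ideal.span {π})]
  nth_rw 2 [← card_ker_mul h]
  congr 1
  refine Nat.card_congr (Equiv.subtypeEquivRight fun r => ?_)
  rw [Ideal.mem_span_singleton]
  refine ⟨?_, h.dvd_of_mul_eq_zero r⟩
  rintro ⟨s, rfl⟩
  rw [← mul_assoc, h.mul_self, zero_mul]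

theorem HasType.card_torsion (h : IsSquareZeroUniformizer π) {N : Type*} [AddCommGroup N]
    [Module R N] {a b : ℕ} (hN : HasType π N a b) :
    Nat.card {v : N // π • v = 0} = Nat.card (R ⧸ Ideal.span {π}) ^ (a + b) := by
  have := finite_residue (π := π)
  obtain ⟨e⟩ := hN
  have h0 : ∀ v : R ⧸ Ideal.span {π}, π • v = 0 := by
    intro v
    obtain ⟨r, rfl⟩ := Ideal.Quotient.mk_surjective v
    exact (Ideal.Quotient.eq_zero_iff_dvd _ _).2 (dvd_mul_right π r)
  let e₁ : {v : N // π • v = 0} ≃ {v : (Fin a → R) × (Fin b → R ⧸ Ideal.span {π}) // π • v = 0} :=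
    e.toEquiv.subtypeEquiv fun v => by
      rw [← e.map_eq_zero_iff, map_smul]; rfl
  let e₂ : {v : (Fin a → R) × (Fin b → R ⧸ Ideal.span {π}) // π • v = 0} ≃
      (Fin a → {r : R // π * r = 0}) × (Fin b → R ⧸ Ideal.span {π}) :=
    { toFun := fun v => (fun i => ⟨v.1.1 i, congrFun (congrArg Prod.fst v.2) i⟩, v.1.2)
      invFun := fun v => ⟨(fun i => (v.1 i).1, v.2), Prod.ext (funext fun i => (v.1 i).2)
        (funext fun i => h0 _)⟩
      left_inv := fun v => rfl
      right_inv := fun v => rfl }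
  rw [Nat.card_congr (e₁.trans e₂), Nat.card_prod, Nat.card_fun, Nat.card_fun, card_ker_mul h,
    Nat.card_eq_fintype_card (α := Fin a), Nat.card_eq_fintype_card (α := Fin b), Fintype.card_fin,
    Fintype.card_fin, pow_add]

/-- Together with the number of torsion elements, this recovers `a` and `b`, since `R` has as many
elements as the square of the residue field. -/
theorem HasType.card_eq (h : IsSquareZeroUniformizer π) {N : Type*} [AddCommGroup N]
    [Module R N] {a b : ℕ} (hN : HasType π N a b) :
    Nat.card N = Nat.card (R ⧸ Ideal.span {π}) ^ (a + (a + b)) := by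
  have := finite_residue (π := π)
  obtain ⟨e⟩ := hN
  rw [Nat.card_congr e.toEquiv, Nat.card_prod, Nat.card_fun, Nat.card_fun, card_eq_sq h,
    Nat.card_eq_fintype_card (α := Fin a), Nat.card_eq_fintype_card (α := Fin b), Fintype.card_fin,
    Fintype.card_fin]
  ring

theorem one_lt_card_residue [(Ideal.span {π}).IsMaximal] :
    1 < Nat.card (R ⧸ Ideal.span {π}) :=
  have := finite_residue (π := π)
  Finite.one_lt_card

theorem hasRank_iff_of_smul_eq_zero (h : IsSquareZeroUniformizer π) [(Ideal.span {π}).IsMaximal]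
    {N : Type*} [AddCommGroup N] [Module R N] [Finite N] (hN : ∀ v : N, π • v = 0) (r : ℕ) :
    HasRank π N r ↔ Nat.card N = Nat.card (R ⧸ Ideal.span {π}) ^ r := by
  have hcard : Nat.card {v : N // π • v = 0} = Nat.card N :=
    Nat.card_congr (Equiv.subtypeUnivEquiv hN)
  constructor
  · rintro ⟨a, b, rfl, hab⟩
    rw [← hcard, hab.card_torsion h]
  · intro hr
    have htors : IsTorsionBySet R N (Ideal.span {π} : Ideal R) := by
      rw [Module.isTorsionBySet_span_singleton_iff]
      exact fun v => hN v
    let _ := htors.module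
    have : IsScalarTower R (R ⧸ Ideal.span {π}) N := htors.isScalarTower
    have : Module.Finite (R ⧸ Ideal.span {π}) N := Module.Finite.of_finite
    let b := Module.finBasis (R ⧸ Ideal.span {π}) N
    let e := (b.equivFun.restrictScalars R).trans
      (LinearEquiv.uniqueProd (R := R) (M := Fin (finrank (R ⧸ Ideal.span {π}) N) → R ⧸ Ideal.span {π})
        (M₂ := Fin 0 → R)).symm
    have hT : HasType π N 0 (finrank (R ⧸ Ideal.span {π}) N) := ⟨e⟩
    refine ⟨_, _, ?_, hT⟩
    have h1 := hT.card_torsion h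
    rw [hcard, hr] at h1
    exact (Nat.pow_right_injective one_lt_card_residue h1).symm

end Types

/-! ### The three dimensions of a flag and conjugacy of flags. -/

section Dimensions

variable {R K : Type*} [CommRing R] [Field K] [Algebra R K] {π : R} {n : ℕ}
  {q : (Fin n → R) →ₗ[R] (Fin n → K)} {j : (Fin n → K) →ₗ[R] (Fin n → R)}

variable (K) in
/-- The dimensions of `πx₂`, `x₁` and `x₂[π]`. -/
noncomputable def flagDims (q : (Fin n → R) →ₗ[R] (Fin n → K))
    (j : (Fin n → K) →ₗ[R] (Fin n → R)) (x : TwoFlag R n) : ℕ × ℕ × ℕ :=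
  (finrank K (red K q x.top), finrank K (tor K j x.bot), finrank K (tor K j x.top))

theorem card_filter_le_eq_add {κ : Type*} [Fintype κ] (r : κ → ℕ) (i : ℕ) :
    (Finset.univ.filter fun l => i ≤ r l).card =
      Fintype.card {l // r l = i} + (Finset.univ.filter fun l => i + 1 ≤ r l).card := by
  classical
  rw [Fintype.card_subtype, ← Finset.card_union_of_disjoint]
  · congr 1
    ext l
    simp only [Finset.mem_union, Finset.mem_filter, Finset.mem_univ, true_and]
    omega
  · rw [Finset.disjoint_filter]
    intro l _ h1 h2
    omega

/-- Two finite families of labels with the same multiplicities differ by a bijection. -/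
theorem exists_equiv_of_card_le_eq {κ κ' : Type*} [Fintype κ] [Fintype κ'] (r : κ → ℕ)
    (r' : κ' → ℕ)
    (hr : ∀ i, (Finset.univ.filter fun l => i ≤ r l).card =
      (Finset.univ.filter fun l => i ≤ r' l).card) :
    ∃ e : κ ≃ κ', ∀ l, r' (e l) = r l := by
  classical
  have hfib : ∀ i, Fintype.card {l // r l = i} = Fintype.card {l // r' l = i} := by
    intro i
    have h1 := card_filter_le_eq_add r i
    have h2 := card_filter_le_eq_add r' i
    rw [hr, hr] at h1
    omega
  refine ⟨(Equiv.sigmaFiberEquiv r).symm.trans ((Equiv.sigmaCongrRight fun i =>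
    Fintype.equivOfCardEq (hfib i)).trans (Equiv.sigmaFiberEquiv r')), fun l => ?_⟩
  exact ((Fintype.equivOfCardEq (hfib (r l))) ⟨l, rfl⟩).2

namespace IsReduction

variable (h : IsReduction K π q j)
include h

theorem flagDims_row {t : ℕ} {c : Fin 4 → Fin 4 → ℕ} {y x : TwoFlag R n}
    (hp : PairPosition π t c y.top y.bot x.top x.bot) :
    flagDims K q j y = (rankInf t c 3 0, rankInf t c 2 0, rankInf t c 1 0) := by
  have key : ∀ i, finrank K (reducedFlag K q j y.top y.bot i) = rankInf t c i 0 := by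
    intro i
    have htop : reducedFlag K q j y.top y.bot i ⊓ reducedFlag K q j x.top x.bot 0 =
        reducedFlag K q j y.top y.bot i := inf_top_eq _
    rw [← h.finrank_reducedFlag_inf hp, htop]
  rw [← key, ← key, ← key]
  rfl

theorem flagDims_col {t : ℕ} {c : Fin 4 → Fin 4 → ℕ} {y x : TwoFlag R n}
    (hp : PairPosition π t c y.top y.bot x.top x.bot) :
    flagDims K q j x = (rankInf t c 0 3, rankInf t c 0 2, rankInf t c 0 1) := by
  have key : ∀ i, finrank K (reducedFlag K q j x.top x.bot i) = rankInf t c 0 i := by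
    intro i
    have htop : reducedFlag K q j y.top y.bot 0 ⊓ reducedFlag K q j x.top x.bot i =
        reducedFlag K q j x.top x.bot i := top_inf_eq _
    rw [← h.finrank_reducedFlag_inf hp, htop]
  rw [← key, ← key, ← key]
  rfl

/-- Flags with the same dimensions are conjugate. -/
theorem exists_map_eq_of_flagDims_eq {x x' : TwoFlag R n} (hx : IsPreflag π x.top x.bot)
    (hx' : IsPreflag π x'.top x'.bot) (hd : flagDims K q j x = flagDims K q j x') :
    ∃ φ : (Fin n → R) ≃ₗ[R] (Fin n → R), x.map φ = x' := by
  classical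
  -- The normal form of the pair `(x, x)` is used only to obtain a basis adapted to the single flag
  -- `x`.
  obtain ⟨t, c, b, hb, -⟩ := h.exists_pairPosition hx hx
  obtain ⟨t', c', b', hb', -⟩ := h.exists_pairPosition hx' hx'
  obtain ⟨B, hB⟩ := h.exists_basis_reduction b
  obtain ⟨B', hB'⟩ := h.exists_basis_reduction b'
  have hcard := fun i => (congrArg (fun W : Submodule K (Fin n → K) => finrank K W)
    (h.reducedFlag_eq_span hB rowLabel_le hb i)).trans (finrank_span_image B _)
  have hcard' := fun i => (congrArg (fun W : Submodule K (Fin n → K) => finrank K W)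
    (h.reducedFlag_eq_span hB' rowLabel_le hb' i)).trans (finrank_span_image B' _)
  have hd1 : finrank K (red K q x.top) = finrank K (red K q x'.top) := congrArg (·.1) hd
  have hd2 : finrank K (tor K j x.bot) = finrank K (tor K j x'.bot) := congrArg (·.2.1) hd
  have hd3 : finrank K (tor K j x.top) = finrank K (tor K j x'.top) := congrArg (·.2.2) hd
  obtain ⟨e, he⟩ := exists_equiv_of_card_le_eq (rowLabel : PairIndex t c → ℕ)
    (rowLabel : PairIndex t' c' → ℕ) (fun i => by
      rw [← hcard, ← hcard']
      match i with
      | 0 => rfl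
      | 1 => exact hd3
      | 2 => exact hd2
      | 3 => exact hd1
      | i + 4 => rfl)
  have hbe : ((b.equiv b' e : (Fin n → R) ≃ₗ[R] (Fin n → R)) :
      (Fin n → R) →ₗ[R] (Fin n → R)) ∘ b = b' ∘ e := by
    ext l; simp
  have h1 := hb.map ((b.equiv b' e : (Fin n → R) ≃ₗ[R] (Fin n → R)) :
    (Fin n → R) →ₗ[R] (Fin n → R))
  have h2 := hb'.reindex e
  have hlab : rowLabel ∘ e = (rowLabel : PairIndex t c → ℕ) := funext he
  rw [hbe] at h1
  rw [hlab] at h2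
  obtain ⟨h3, h4⟩ := h1.eq_of_eq h2
  exact ⟨b.equiv b' e, TwoFlag.ext h3 h4⟩

theorem q_eq_zero_iff (m : Fin n → R) : q m = 0 ↔ π • m = 0 := by
  rw [← h.comp]
  exact ⟨fun hm => by rw [hm, map_zero], fun hm => h.inj (by rw [hm, map_zero])⟩

theorem card_torsion (N : Submodule R (Fin n → R)) :
    Nat.card {v : N // π • v = 0} = Nat.card K ^ finrank K (tor K j N) := by
  rw [← Module.natCard_eq_pow_finrank]
  refine (Nat.card_congr (Equiv.ofBijective (fun v : tor K j N =>
    (⟨⟨j v, h.mem_tor.1 v.2⟩, Subtype.ext (h.smul_j _)⟩ : {v : N // π • v = 0})) ⟨?_, ?_⟩)).symm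
  · intro u v huv
    exact Subtype.ext (h.inj (congrArg (fun w => (w.1 : Fin n → R)) huv))
  · rintro ⟨⟨m, hm⟩, hm'⟩
    obtain ⟨v, rfl⟩ := h.exists_j_of_smul_eq_zero (congrArg Subtype.val hm')
    exact ⟨⟨v, h.mem_tor.2 hm⟩, rfl⟩

/-- Restricted to `N`, the map `q` has kernel the torsion of `N` and image its reduction. -/
theorem card_submodule (N : Submodule R (Fin n → R)) :
    Nat.card N = Nat.card K ^ (finrank K (red K q N) + finrank K (tor K j N)) := by
  rw [pow_add, ← h.card_torsion, ← Module.natCard_eq_pow_finrank,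
    Submodule.card_eq_card_quotient_mul_card (LinearMap.ker (q.domRestrict N))]
  have h1 : Nat.card (LinearMap.ker (q.domRestrict N)) = Nat.card {v : N // π • v = 0} :=
    Nat.card_congr (Equiv.subtypeEquivRight fun v => by
      rw [LinearMap.mem_ker, LinearMap.domRestrict_apply, h.q_eq_zero_iff, Subtype.ext_iff]
      rfl)
  have h2 : Nat.card (N ⧸ LinearMap.ker (q.domRestrict N)) = Nat.card (red K q N) := by
    rw [Nat.card_congr (q.domRestrict N).quotKerEquivRange.toEquiv]
    refine Nat.card_congr (Equiv.subtypeEquivRight fun v => ?_)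
    rw [LinearMap.range_domRestrict, h.mem_red, mem_map]
  rw [h1, h2, mul_comm]

end IsReduction

end Dimensions

/-! ### Membership in `𝓢_λ` and equivalence of flags as conditions on dimensions. -/

section ParameterFlags

attribute [local instance] Ideal.Quotient.field

variable {R : Type*} [CommRing R] [Finite R] {π : R} (h₀ : IsSquareZeroUniformizer π)
  [(Ideal.span {π}).IsMaximal] {n A B : ℕ}
  {q : (Fin n → R) →ₗ[R] (Fin n → R ⧸ Ideal.span {π})}
  {j : (Fin n → R ⧸ Ideal.span {π}) →ₗ[R] (Fin n → R)}

namespace IsReduction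

variable (h : IsReduction (R ⧸ Ideal.span {π}) π q j)
include h

theorem card_pow_inj {a b : ℕ} : Nat.card (R ⧸ Ideal.span {π}) ^ a =
    Nat.card (R ⧸ Ideal.span {π}) ^ b ↔ a = b :=
  Nat.pow_right_inj one_lt_card_residue

theorem card_of_smul_eq_zero {N : Submodule R (Fin n → R)} (hN : ∀ m ∈ N, π • m = 0) :
    Nat.card N = Nat.card (R ⧸ Ideal.span {π}) ^
      finrank (R ⧸ Ideal.span {π}) (tor (R ⧸ Ideal.span {π}) j N) := by
  rw [← h.card_torsion]
  exact (Nat.card_congr (Equiv.subtypeUnivEquiv fun v : N => Subtype.ext (hN v v.2))).symm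

/-- Isomorphisms preserve the orders of `y₁`, `y₂` and `y₂[π]`, which give the three dimensions;
conversely, flags of equal dimensions are even conjugate under automorphisms of `R^n`. -/
theorem flagEquiv_iff {y x : TwoFlag R n} (hy : IsPreflag π y.top y.bot)
    (hx : IsPreflag π x.top x.bot) :
    FlagEquiv y x ↔ flagDims (R ⧸ Ideal.span {π}) q j y = flagDims (R ⧸ Ideal.span {π}) q j x := by
  constructor
  · rintro ⟨φ₂, φ₁, -⟩
    have h1 := Nat.card_congr φ₁.toEquiv
    rw [h.card_of_smul_eq_zero hy.smul_eq_zero, h.card_of_smul_eq_zero hx.smul_eq_zero,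
      h.card_pow_inj] at h1
    have h2 := Nat.card_congr φ₂.toEquiv
    rw [h.card_submodule, h.card_submodule, h.card_pow_inj] at h2
    have h3 : Nat.card {v : y.top // π • v = 0} = Nat.card {v : x.top // π • v = 0} :=
      Nat.card_congr (φ₂.toEquiv.subtypeEquiv fun v => by
        rw [← φ₂.map_eq_zero_iff, map_smul]; rfl)
    rw [h.card_torsion, h.card_torsion, h.card_pow_inj] at h3
    refine Prod.ext ?_ (Prod.ext h1 h3)
    simp only [flagDims]
    omega
  · intro hd
    obtain ⟨φ, rfl⟩ := h.exists_map_eq_of_flagDims_eq hy hx hd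
    exact ⟨φ.submoduleMap y.top, φ.submoduleMap y.bot, fun v => rfl⟩

theorem tor_piMul (N : Submodule R (Fin n → R)) :
    tor (R ⧸ Ideal.span {π}) j (piMul π N) = red (R ⧸ Ideal.span {π}) q N := by
  ext v
  rw [h.mem_tor, h.mem_red]
  constructor
  · rintro ⟨m, hm, hmv⟩
    exact ⟨m, hm, h.inj ((h.comp m).trans hmv)⟩
  · rintro ⟨m, hm, rfl⟩
    exact ⟨m, hm, (h.comp m).symm⟩

theorem isPreflag_iota (N : Submodule R (Fin n → R)) :
    IsPreflag π (iota π N).top (iota π N).bot where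
  le := (iota π N).bot_le_top
  smul_mem m hm := ⟨m, hm, rfl⟩
  smul_eq_zero := by
    rintro _ ⟨m, -, rfl⟩
    simp [smul_smul, h.mul_self]

include h₀

theorem finrank_of_hasType {N : Submodule R (Fin n → R)} (hN : HasType π N A B) :
    finrank (R ⧸ Ideal.span {π}) (red (R ⧸ Ideal.span {π}) q N) = A ∧
      finrank (R ⧸ Ideal.span {π}) (tor (R ⧸ Ideal.span {π}) j N) = A + B := by
  have h1 := hN.card_torsion h₀
  have h2 := hN.card_eq h₀
  rw [h.card_torsion, h.card_pow_inj] at h1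
  rw [h.card_submodule, h.card_pow_inj] at h2
  omega

theorem flagDims_iota {N : Submodule R (Fin n → R)} (hN : HasType π N A B) :
    flagDims (R ⧸ Ideal.span {π}) q j (iota π N) = (A, A, A + B) := by
  obtain ⟨h1, h2⟩ := h.finrank_of_hasType h₀ hN
  refine Prod.ext h1 (Prod.ext ?_ h2)
  exact (congrArg (fun W : Submodule _ (Fin n → R ⧸ Ideal.span {π}) => finrank _ W)
    (h.tor_piMul N)).trans h1

theorem hasRank_bot_iff {x : TwoFlag R n} (hx : IsPreflag π x.top x.bot) (r : ℕ) :
    HasRank π x.bot r ↔ r = (flagDims (R ⧸ Ideal.span {π}) q j x).2.1 := by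
  rw [hasRank_iff_of_smul_eq_zero h₀ (fun v => Subtype.ext (hx.smul_eq_zero v v.2)),
    h.card_of_smul_eq_zero hx.smul_eq_zero, h.card_pow_inj]
  exact eq_comm

theorem hasRank_quotient_iff {x : TwoFlag R n} (hx : IsPreflag π x.top x.bot) (s : ℕ) :
    HasRank π (x.top ⧸ x.bot.submoduleOf x.top) s ↔
      s + (flagDims (R ⧸ Ideal.span {π}) q j x).2.1 =
        (flagDims (R ⧸ Ideal.span {π}) q j x).1 + (flagDims (R ⧸ Ideal.span {π}) q j x).2.2 := by
  have hkill : ∀ v : x.top ⧸ x.bot.submoduleOf x.top, π • v = 0 := by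
    intro v
    obtain ⟨m, rfl⟩ := Submodule.mkQ_surjective _ v
    rw [← map_smul, mkQ_apply, Submodule.Quotient.mk_eq_zero]
    exact hx.smul_mem m m.2
  have hfin : Finite (x.top ⧸ x.bot.submoduleOf x.top) :=
    Finite.of_surjective _ (Submodule.mkQ_surjective _)
  have hpos : 0 < Nat.card x.bot := Nat.card_pos
  have h1 := Submodule.card_eq_card_quotient_mul_card (x.bot.submoduleOf x.top)
  rw [Nat.card_congr (Submodule.submoduleOfEquivOfLe x.bot_le_top).toEquiv, h.card_submodule,
    h.card_of_smul_eq_zero hx.smul_eq_zero] at h1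
  rw [h.card_of_smul_eq_zero hx.smul_eq_zero] at hpos
  rw [hasRank_iff_of_smul_eq_zero h₀ hkill, ← Nat.mul_right_inj hpos.ne', ← h1, ← pow_add,
    h.card_pow_inj]
  simp only [flagDims]
  omega

/-- The flags in `𝓢_λ` in terms of dimensions. -/
theorem isParamFlag_iff (hn : A + B ≤ n) {y₀ : Submodule R (Fin n → R)} (hy₀ : HasType π y₀ A B)
    (x : TwoFlag R n) : IsParamFlag π A B x ↔ IsPreflag π x.top x.bot ∧
      2 * (flagDims (R ⧸ Ideal.span {π}) q j x).2.1 ≤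
        (flagDims (R ⧸ Ideal.span {π}) q j x).2.2 + (flagDims (R ⧸ Ideal.span {π}) q j x).1 ∧
      (flagDims (R ⧸ Ideal.span {π}) q j x).2.1 ≤ A ∧
      (flagDims (R ⧸ Ideal.span {π}) q j x).2.2 ≤ A + B := by
  constructor
  · rintro ⟨hpi, ⟨y, hy, φ₂, φ₁, i₂, i₁, -⟩, r, s, hr, hs, hrs⟩
    have hkill : ∀ m ∈ x.bot, π • m = 0 := by
      intro m hm
      have h1 : φ₁ (π • ⟨m, hm⟩) = 0 := by
        rw [map_smul]
        exact Subtype.ext ((h.isPreflag_iota y).smul_eq_zero _ (φ₁ ⟨m, hm⟩).2)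
      exact congrArg Subtype.val (i₁ (h1.trans (map_zero φ₁).symm))
    have hx : IsPreflag π x.top x.bot := ⟨x.bot_le_top, fun m hm => hpi ⟨m, hm, rfl⟩, hkill⟩
    have hdim := h.flagDims_iota h₀ hy
    have hS : (flagDims (R ⧸ Ideal.span {π}) q j x).2.1 ≤ A := by
      have h1 := Nat.card_le_card_of_injective φ₁ i₁
      rw [h.card_of_smul_eq_zero hkill, h.card_of_smul_eq_zero (h.isPreflag_iota y).smul_eq_zero,
        Nat.pow_le_pow_iff_right one_lt_card_residue] at h1
      exact h1.trans (congrArg (·.2.1) hdim).le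
    have hT : (flagDims (R ⧸ Ideal.span {π}) q j x).2.2 ≤ A + B := by
      have h1 : Nat.card {v : x.top // π • v = 0} ≤ Nat.card {v : (iota π y).top // π • v = 0} :=
        Nat.card_le_card_of_injective (fun v => ⟨φ₂ v.1, by rw [← map_smul, v.2, map_zero]⟩)
          fun u v huv => Subtype.ext (i₂ (congrArg Subtype.val huv))
      rw [h.card_torsion, h.card_torsion, Nat.pow_le_pow_iff_right one_lt_card_residue] at h1
      exact h1.trans (congrArg (·.2.2) hdim).le
    rw [h.hasRank_bot_iff h₀ hx] at hr
    rw [h.hasRank_quotient_iff h₀ hx] at hs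
    exact ⟨hx, by omega, hS, hT⟩
  · rintro ⟨hx, hrank, hS, hT⟩
    refine ⟨?_, ?_, _, (flagDims (R ⧸ Ideal.span {π}) q j x).1 +
      (flagDims (R ⧸ Ideal.span {π}) q j x).2.2 - (flagDims (R ⧸ Ideal.span {π}) q j x).2.1,
      (h.hasRank_bot_iff h₀ hx _).2 rfl, (h.hasRank_quotient_iff h₀ hx _).2 (by omega), by omega⟩
    · rintro _ ⟨m, hm, rfl⟩
      exact hx.smul_mem m hm
    · obtain ⟨P, S, T, hPST⟩ : ∃ P S T, flagDims (R ⧸ Ideal.span {π}) q j x = (P, S, T) :=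
        ⟨_, _, _, rfl⟩
      rw [hPST] at hrank hS hT
      simp only at hrank hS hT
      have hanti := h.reducedFlag_antitone hx
      have hPS : P ≤ S := by
        have := Submodule.finrank_mono (hanti (show 2 ≤ 3 by norm_num))
        have h1 : P = _ := (congrArg (·.1) hPST).symm
        have h2 : S = _ := (congrArg (·.2.1) hPST).symm
        rw [h1, h2]; exact this
      have hST : S ≤ T := by
        have := Submodule.finrank_mono (hanti (show 1 ≤ 2 by norm_num))
        have h1 : S = _ := (congrArg (·.2.1) hPST).symm
        have h2 : T = _ := (congrArg (·.2.2) hPST).symm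
        rw [h1, h2]; exact this
      have hTn : T ≤ n := hT.trans hn
      -- An explicit position with row dimensions `(P, S, T)`, column dimensions `(A, A, A + B)` and
      -- row labels at most column labels. Of the `A - S` vectors that must be added to reach column
      -- label `3`, as many as possible (`u`) are taken from row `1` and the rest from row `0`; this
      -- keeps `c 0 1` within the bound `T ≤ A + B`.
      set u := min (A - S) (T - S) with hu
      set c : Fin 4 → Fin 4 → ℕ := ![![n - A - B, A + B - T - (A - S - u), 0, A - S - u],
        ![0, T - S - u, 0, u], ![0, 0, 0, S - P], ![0, 0, 0, P]] with hc
      obtain ⟨y₂, y₁, x₂, x₁, hp⟩ := exists_of_pairPosition π (Pi.basisFun R (Fin n)) (t := 0)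
        (c := c) (by
          simp [hc, Fin.sum_univ_four]
          omega)
      obtain ⟨b, hby, hbx⟩ := id hp
      have hpy := h.isPreflag_of_flagAdapted hby
      have hpx := h.isPreflag_of_flagAdapted hbx
      let y : TwoFlag R n := ⟨y₂, y₁, hpy.le⟩
      let z : TwoFlag R n := ⟨x₂, x₁, hpx.le⟩
      have hp' : PairPosition π 0 c y.top y.bot z.top z.bot := hp
      have hdy := h.flagDims_row hp'
      have hdz := h.flagDims_col hp'
      have hle := le_of_pairPosition hp' (by simp [hc])
      simp [rankInf, hc, Fin.sum_univ_four] at hdy hdz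
      obtain ⟨φ, hφ⟩ := h.exists_map_eq_of_flagDims_eq (x := y) hpy hx (by
        rw [hdy, hPST]
        refine Prod.ext rfl (Prod.ext ?_ ?_) <;> simp only <;> omega)
      obtain ⟨φ', hφ'⟩ := h.exists_map_eq_of_flagDims_eq (x := iota π y₀) (x' := z)
        (h.isPreflag_iota y₀) hpx (by
          rw [hdz, h.flagDims_iota h₀ hy₀]
          refine Prod.ext ?_ (Prod.ext ?_ ?_) <;> simp only <;> omega)
      have hpimap : ∀ (ψ : (Fin n → R) ≃ₗ[R] (Fin n → R)) (N : Submodule R (Fin n → R)),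
          (piMul π N).map (ψ : (Fin n → R) →ₗ[R] (Fin n → R)) =
            piMul π (N.map (ψ : (Fin n → R) →ₗ[R] (Fin n → R))) := by
        intro ψ N
        rw [piMul, piMul, ← Submodule.map_comp, ← Submodule.map_comp]
        congr 1
        exact LinearMap.ext fun m => map_smul ψ π m
      -- The model pair is moved onto the given flag: `φ'` carries `ι(y₀)` to the model `z`, and `φ`
      -- carries the model `y` to `x`.
      set N := (y₀.map (φ' : (Fin n → R) →ₗ[R] (Fin n → R))).map
        (φ : (Fin n → R) →ₗ[R] (Fin n → R)) with hN
      have htop : x.top ≤ N := by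
        rw [← hφ, hN]
        refine map_mono (hle.1.trans (le_of_eq ?_))
        exact (congrArg TwoFlag.top hφ').symm
      have hbot : x.bot ≤ piMul π N := by
        rw [← hφ, hN, ← hpimap, ← hpimap]
        refine map_mono (hle.2.trans (le_of_eq ?_))
        exact (congrArg TwoFlag.bot hφ').symm
      refine ⟨N, ?_, inclusion htop, inclusion hbot, inclusion_injective _, inclusion_injective _,
        fun v => rfl⟩
      obtain ⟨e⟩ := hy₀
      exact ⟨((φ'.submoduleMap y₀).trans (φ.submoduleMap _)).symm.trans e⟩

end IsReduction

end ParameterFlags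

/-! ### RSK for matrices with two rows and three columns. -/

section Correspondence

/-- The numbers `(t, c)` describe the position of a pair of flags in an `n`-dimensional space whose
members have the dimensions `rd` and `cd`. -/
def IsPositionData (n : ℕ) (rd cd : ℕ × ℕ × ℕ) (d : ℕ × (Fin 4 → Fin 4 → ℕ)) : Prop :=
  n = d.1 + d.1 + ∑ a, ∑ b, d.2 a b ∧
    (rankInf d.1 d.2 3 0, rankInf d.1 d.2 2 0, rankInf d.1 d.2 1 0) = rd ∧
    (rankInf d.1 d.2 0 3, rankInf d.1 d.2 0 2, rankInf d.1 d.2 0 1) = cd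

/-- The position described by `(t, c)` is that of a permissible embedding. -/
def IsPermissibleData (d : ℕ × (Fin 4 → Fin 4 → ℕ)) : Prop :=
  d.1 = 0 ∧ d.2 3 0 = 0 ∧ d.2 3 1 = 0 ∧ d.2 3 2 = 0 ∧ Interlacing d.2

theorem isPositionData_iff {n P S T P' S' T' t : ℕ} {c : Fin 4 → Fin 4 → ℕ} :
    IsPositionData n (P, S, T) (P', S', T') (t, c) ↔
      n = t + t + (c 0 0 + c 0 1 + c 0 2 + c 0 3 + (c 1 0 + c 1 1 + c 1 2 + c 1 3) +
        (c 2 0 + c 2 1 + c 2 2 + c 2 3) + (c 3 0 + c 3 1 + c 3 2 + c 3 3)) ∧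
      (P = t + (c 3 0 + c 3 1 + c 3 2 + c 3 3) ∧ S = P + (c 2 0 + c 2 1 + c 2 2 + c 2 3) ∧
        T = S + (c 1 0 + c 1 1 + c 1 2 + c 1 3)) ∧
      P' = t + (c 0 3 + c 1 3 + c 2 3 + c 3 3) ∧ S' = P' + (c 0 2 + c 1 2 + c 2 2 + c 3 2) ∧
        T' = S' + (c 0 1 + c 1 1 + c 2 1 + c 3 1) := by
  simp [IsPositionData, rankInf, Fin.sum_univ_four]
  omega

/-- The matrix with the given entries. -/
def matrixOf (c00 c01 c02 c03 c10 c11 c12 c13 c20 c21 c22 c23 c30 c31 c32 c33 : ℕ) :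
    Fin 4 → Fin 4 → ℕ :=
  ![![c00, c01, c02, c03], ![c10, c11, c12, c13], ![c20, c21, c22, c23], ![c30, c31, c32, c33]]

theorem eq_matrixOf (c : Fin 4 → Fin 4 → ℕ) : c = matrixOf (c 0 0) (c 0 1) (c 0 2) (c 0 3)
    (c 1 0) (c 1 1) (c 1 2) (c 1 3) (c 2 0) (c 2 1) (c 2 2) (c 2 3) (c 3 0) (c 3 1) (c 3 2)
    (c 3 3) := by
  ext a b
  fin_cases a <;> fin_cases b <;> rfl

/-- The Robinson-Schensted-Knuth correspondence for the matrix with two rows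
`(c 1 1, c 1 2, c 1 3)` and `(c 3 1, c 3 2, t)`: the tableau in `d₁` records the row lengths, and
the first rows of the tableau in `d₂` are given by Greene's theorem. -/
def RSKRelated (d d₁ d₂ : ℕ × (Fin 4 → Fin 4 → ℕ)) : Prop :=
  d₁.2 3 3 = d.2 3 3 ∧ d₂.2 3 3 = d.2 3 3 ∧ d₁.2 1 1 = d.2 1 1 + d.2 1 2 + d.2 1 3 ∧
    d₂.2 1 1 = d.2 1 1 + d.2 3 1 ∧ d₂.2 1 2 + d₂.2 2 2 = d.2 1 2 + d.2 3 2 ∧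
    d₂.2 1 3 + d₂.2 2 3 = d.2 1 3 + d.1 ∧
    d₂.2 1 1 + d₂.2 1 2 = d.2 3 2 + max (d.2 1 1 + d.2 3 1) (d.2 1 1 + d.2 1 2) ∧
    d₂.2 1 1 + d₂.2 1 2 + d₂.2 1 3 = d.1 + max (d₂.2 1 1 + d₂.2 1 2) (d₁.2 1 1)

variable {n A B P S T : ℕ} {rd : ℕ × ℕ × ℕ} {d d₁ d₂ d' d₁' d₂' : ℕ × (Fin 4 → Fin 4 → ℕ)}

/-- The forward correspondence. With `p` for row `1` and `q` for row `3` of the matrix (`q₃` being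
the number of twisted blocks), the first row of the second tableau is given by heaviest lattice
paths. -/
theorem exists_rskRelated_right (hn : 2 * (A + B) ≤ n) (hT : T ≤ A + B)
    (hd : IsPositionData n (A, A, A + B) (P, S, T) d) :
    ∃ d₁ d₂, RSKRelated d d₁ d₂ ∧ IsPermissibleData d₁ ∧ IsPermissibleData d₂ ∧
      ∃ rd, IsPositionData n rd (A, A, A + B) d₁ ∧ IsPositionData n rd (P, S, T) d₂ := by
  obtain ⟨q₃, c⟩ := d
  rw [isPositionData_iff] at hd
  generalize h00 : c 0 0 = c00 at hd
  generalize h01 : c 0 1 = c01 at hd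
  generalize h02 : c 0 2 = c02 at hd
  generalize h03 : c 0 3 = c03 at hd
  generalize h10 : c 1 0 = c10 at hd
  generalize h11 : c 1 1 = p₁ at hd
  generalize h12 : c 1 2 = p₂ at hd
  generalize h13 : c 1 3 = p₃ at hd
  generalize h30 : c 3 0 = c30 at hd
  generalize h31 : c 3 1 = q₁ at hd
  generalize h32 : c 3 2 = q₂ at hd
  generalize h33 : c 3 3 = e at hd
  -- Each difference becomes a new natural number once its nonnegativity is checked. The `x1k` are
  -- increments of the path maxima, and the `x2k` count the letters `k` pushed into the second row.
  obtain ⟨x12, hx12⟩ := Nat.exists_eq_add_of_le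
    (show p₁ + q₁ ≤ q₂ + max (p₁ + q₁) (p₁ + p₂) by omega)
  obtain ⟨x22, hx22⟩ := Nat.exists_eq_add_of_le (show x12 ≤ p₂ + q₂ by omega)
  obtain ⟨x13, hx13⟩ := Nat.exists_eq_add_of_le
    (show p₁ + q₁ + x12 ≤ q₃ + max (p₁ + q₁ + x12) (p₁ + p₂ + p₃) by omega)
  obtain ⟨x23, hx23⟩ := Nat.exists_eq_add_of_le (show x13 ≤ p₃ + q₃ by omega)
  obtain ⟨a13, ha13⟩ := Nat.exists_eq_add_of_le
    (show p₁ + p₂ + p₃ ≤ p₁ + q₁ + x12 + x13 by omega)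
  -- The remaining entries are forced by the marginals `A`, `B`, `T` and the total `n`.
  obtain ⟨a01, ha01⟩ := Nat.exists_eq_add_of_le (show p₁ + p₂ + p₃ ≤ B by omega)
  obtain ⟨a03, ha03⟩ := Nat.exists_eq_add_of_le (show e + a13 + (x22 + x23) ≤ A by omega)
  obtain ⟨a00, ha00⟩ := Nat.exists_eq_add_of_le (show A + B ≤ n by omega)
  obtain ⟨z, hz⟩ := Nat.exists_eq_add_of_le (show T ≤ n by omega)
  -- Column strictness of the two tableaux: `hb1` and `hb2` for the second, `hb3` for the first.
  have hb1 : x22 ≤ p₁ + q₁ := by omega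
  have hb2 : x22 + x23 ≤ p₁ + q₁ + x12 := by omega
  have hb3 : x22 + x23 ≤ p₁ + p₂ + p₃ := by omega
  refine ⟨(0, matrixOf a00 a01 0 a03 0 (p₁ + p₂ + p₃) 0 a13 0 0 0 (x22 + x23) 0 0 0 e),
    (0, matrixOf z c01 c02 c03 0 (p₁ + q₁) x12 x13 0 0 x22 x23 0 0 0 e), ?_, ?_, ?_,
    (e, e + (x22 + x23), e + (x22 + x23) + (p₁ + q₁ + x12 + x13)), ?_, ?_⟩
  · simp only [RSKRelated, matrixOf, h11, h12, h13, h31, h32, h33]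
    simp
    omega
  · simp only [IsPermissibleData, Interlacing, matrixOf]
    simp
    omega
  · simp only [IsPermissibleData, Interlacing, matrixOf]
    simp
    omega
  · rw [isPositionData_iff]
    simp [matrixOf]
    omega
  · rw [isPositionData_iff]
    simp [matrixOf]
    omega

/-- The inverse correspondence removes columns from the right: the path recursion for the largest
letter gives `q₃`, then `p₃`, and the same recursion for the next letter gives `q₂` and `p₂`. -/
theorem exists_rskRelated_left (hn : 2 * (A + B) ≤ n) (hT : T ≤ A + B)
    (h₁ : IsPermissibleData d₁) (h₂ : IsPermissibleData d₂)
    (hd₁ : IsPositionData n rd (A, A, A + B) d₁) (hd₂ : IsPositionData n rd (P, S, T) d₂) :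
    ∃ d, RSKRelated d d₁ d₂ ∧ IsPositionData n (A, A, A + B) (P, S, T) d := by
  obtain ⟨t₁, a⟩ := d₁
  obtain ⟨t₂, x⟩ := d₂
  obtain ⟨P', S', T'⟩ := rd
  rw [isPositionData_iff] at hd₁ hd₂
  obtain ⟨rfl, ha30, ha31, ha32, ⟨ha10, -, -, -⟩, ha20, ha21, ha22, ha23⟩ := h₁
  obtain ⟨rfl, hx30, hx31, hx32, ⟨hx10, -, -, -⟩, hx20, hx21, hx22, hx23⟩ := h₂
  simp only at ha30 ha31 ha32 ha10 ha20 ha21 ha22 ha23 hx30 hx31 hx32 hx10 hx20 hx21 hx22 hx23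
  have h12 : a 1 2 = 0 := by omega
  have h22 : a 2 2 = 0 := by omega
  have hsum : a 1 1 + a 1 3 = x 1 1 + x 1 2 + x 1 3 := by omega
  have hmu : a 2 3 = x 2 2 + x 2 3 := by omega
  have he : a 3 3 = x 3 3 := by omega
  have hB : a 0 1 + a 1 1 = B := by omega
  have hA : a 0 3 + a 1 3 + a 2 3 + a 3 3 = A := by omega
  have hP : P = x 0 3 + x 1 3 + x 2 3 + x 3 3 := by omega
  have hS : S = P + (x 0 2 + x 1 2 + x 2 2) := by omega
  have hT' : T = S + (x 0 1 + x 1 1) := by omega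
  clear hd₁ hd₂
  obtain ⟨q₃, hq₃⟩ := Nat.exists_eq_add_of_le
    (show max (x 1 1 + x 1 2) (a 1 1) ≤ x 1 1 + x 1 2 + x 1 3 by omega)
  obtain ⟨p₃, hp₃⟩ := Nat.exists_eq_add_of_le (show q₃ ≤ x 1 3 + x 2 3 by omega)
  obtain ⟨r, hr⟩ := Nat.exists_eq_add_of_le (show p₃ ≤ a 1 1 by omega)
  obtain ⟨q₂, hq₂⟩ := Nat.exists_eq_add_of_le (show max (x 1 1) r ≤ x 1 1 + x 1 2 by omega)
  obtain ⟨p₂, hp₂⟩ := Nat.exists_eq_add_of_le (show q₂ ≤ x 1 2 + x 2 2 by omega)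
  obtain ⟨p₁, hp₁⟩ := Nat.exists_eq_add_of_le (show p₂ ≤ r by omega)
  obtain ⟨q₁, hq₁⟩ := Nat.exists_eq_add_of_le (show p₁ ≤ x 1 1 by omega)
  obtain ⟨c30, hc30⟩ := Nat.exists_eq_add_of_le (show x 3 3 + q₁ + q₂ + q₃ ≤ A by omega)
  -- Here `n ≥ 2(A + B)` is needed: `T` is at most `A + B`, while `q₃ + c30` is at most `A` and `a 0
  -- 1` is at most `B`.
  obtain ⟨c00, hc00⟩ := Nat.exists_eq_add_of_le (show T + q₃ + a 0 1 + c30 ≤ n by omega)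
  refine ⟨(q₃, matrixOf c00 (x 0 1) (x 0 2) (x 0 3) (a 0 1) p₁ p₂ p₃ 0 0 0 0 c30 q₁ q₂ (x 3 3)),
    ?_, ?_⟩
  · simp only [RSKRelated, matrixOf]
    simp
    omega
  · rw [isPositionData_iff]
    simp [matrixOf]
    omega

/-- The relation fixes rows `1` and `2` of the second tableau and the entry `(1, 1)` of the first.
Everything else, including the common row dimensions, follows from the marginals and the zeros of
permissible data. -/
theorem RSKRelated.right_unique (h : RSKRelated d d₁ d₂) (h' : RSKRelated d d₁' d₂')
    (h₁ : IsPermissibleData d₁) (h₂ : IsPermissibleData d₂)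
    (hd₁ : IsPositionData n rd (A, A, A + B) d₁) (hd₂ : IsPositionData n rd (P, S, T) d₂)
    (h₁' : IsPermissibleData d₁') (h₂' : IsPermissibleData d₂') {rd' : ℕ × ℕ × ℕ}
    (hd₁' : IsPositionData n rd' (A, A, A + B) d₁') (hd₂' : IsPositionData n rd' (P, S, T) d₂') :
    d₁ = d₁' ∧ d₂ = d₂' := by
  obtain ⟨t, c⟩ := d
  obtain ⟨t₁, a⟩ := d₁
  obtain ⟨t₂, x⟩ := d₂
  obtain ⟨t₁', a'⟩ := d₁'
  obtain ⟨t₂', x'⟩ := d₂'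
  obtain ⟨P₁, S₁, T₁⟩ := rd
  obtain ⟨P₂, S₂, T₂⟩ := rd'
  rw [isPositionData_iff] at hd₁ hd₂ hd₁' hd₂'
  obtain ⟨rfl, ha30, ha31, ha32, ⟨ha10, -, -, -⟩, ha20, ha21, -, -⟩ := h₁
  obtain ⟨rfl, hx30, hx31, hx32, ⟨hx10, -, -, -⟩, hx20, hx21, -, -⟩ := h₂
  obtain ⟨rfl, ha30', ha31', ha32', ⟨ha10', -, -, -⟩, ha20', ha21', -, -⟩ := h₁'
  obtain ⟨rfl, hx30', hx31', hx32', ⟨hx10', -, -, -⟩, hx20', hx21', -, -⟩ := h₂'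
  obtain ⟨r1, r2, r3, r4, r5, r6, r7, r8⟩ := h
  obtain ⟨r1', r2', r3', r4', r5', r6', r7', r8'⟩ := h'
  simp only at r1 r2 r3 r4 r5 r6 r7 r8 r1' r2' r3' r4' r5' r6' r7' r8'
  simp only at ha30 ha31 ha32 ha10 ha20 ha21 hx30 hx31 hx32 hx10 hx20 hx21
  simp only at ha30' ha31' ha32' ha10' ha20' ha21' hx30' hx31' hx32' hx10' hx20' hx21'
  have e0 : a 3 3 = a' 3 3 := by omega
  have e0' : x 3 3 = x' 3 3 := by omega
  have e1 : x 1 1 = x' 1 1 := by omega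
  have e2 : x 1 2 = x' 1 2 := by omega
  have e3 : x 2 2 = x' 2 2 := by omega
  have e4 : a 1 1 = a' 1 1 := by omega
  -- Rewriting first makes the two maxima literally the same term.
  have e5 : x 1 3 = x' 1 3 := by
    rw [e1, e2, e4] at r8
    omega
  have e6 : x 2 3 = x' 2 3 := by omega
  clear r1 r2 r3 r4 r5 r6 r7 r8 r1' r2' r3' r4' r5' r6' r7' r8'
  have e7 : a 1 2 = a' 1 2 := by omega
  have e8 : a 2 2 = a' 2 2 := by omega
  have e9 : a 1 3 = a' 1 3 := by omega
  have e10 : a 2 3 = a' 2 3 := by omega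
  constructor
  · refine Prod.ext rfl ?_
    change a = a'
    rw [eq_matrixOf a, eq_matrixOf a']
    congr 1 <;> omega
  · refine Prod.ext rfl ?_
    change x = x'
    rw [eq_matrixOf x, eq_matrixOf x']
    congr 1 <;> omega

/-- The recursion is solved from the last column backwards: `t`, then `c 1 3`, then the sum `c 1 1 +
c 1 2`, which enters the maximum that determines `c 3 2`. -/
theorem RSKRelated.left_unique (h : RSKRelated d d₁ d₂) (h' : RSKRelated d' d₁ d₂)
    (hd : IsPositionData n (A, A, A + B) (P, S, T) d)
    (hd' : IsPositionData n (A, A, A + B) (P, S, T) d') : d = d' := by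
  obtain ⟨t, c⟩ := d
  obtain ⟨t', c'⟩ := d'
  rw [isPositionData_iff] at hd hd'
  obtain ⟨r1, r2, r3, r4, r5, r6, r7, r8⟩ := h
  obtain ⟨r1', r2', r3', r4', r5', r6', r7', r8'⟩ := h'
  simp only at r1 r2 r3 r4 r5 r6 r7 r8 r1' r2' r3' r4' r5' r6' r7' r8'
  have e0 : c 3 3 = c' 3 3 := by omega
  have e1 : t = t' := by omega
  have e2 : c 1 3 = c' 1 3 := by omega
  have e3 : c 1 1 + c 1 2 = c' 1 1 + c' 1 2 := by omega
  have e4 : c 3 2 = c' 3 2 := by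
    rw [e3, ← r4] at r7
    rw [← r4'] at r7'
    omega
  have e5 : c 1 2 = c' 1 2 := by omega
  have e6 : c 1 1 = c' 1 1 := by omega
  have e7 : c 3 1 = c' 3 1 := by omega
  clear r1 r2 r3 r4 r5 r6 r7 r8 r1' r2' r3' r4' r5' r6' r7' r8'
  refine Prod.ext e1 ?_
  change c = c'
  rw [eq_matrixOf c, eq_matrixOf c']
  congr 1 <;> omega

theorem nonempty_equiv_of_rel {α β : Type*} (r : α → β → Prop) (hl : ∀ a, ∃ b, r a b)
    (hr : ∀ b, ∃ a, r a b) (ul : ∀ a b b', r a b → r a b' → b = b')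
    (ur : ∀ a a' b, r a b → r a' b → a = a') : Nonempty (α ≃ β) := by
  choose f hf using hl
  refine ⟨Equiv.ofBijective f ⟨fun a a' h => ur a a' (f a) (hf a) (h ▸ hf a'), fun b => ?_⟩⟩
  obtain ⟨a, ha⟩ := hr b
  exact ⟨a, ul a _ _ (hf a) ha⟩

/-- The Robinson-Schensted-Knuth correspondence for the positions of pairs of flags. -/
theorem nonempty_positionData_equiv (hn : 2 * (A + B) ≤ n) (hT : T ≤ A + B) :
    Nonempty ({d | IsPositionData n (A, A, A + B) (P, S, T) d} ≃
      {p : (ℕ × (Fin 4 → Fin 4 → ℕ)) × (ℕ × (Fin 4 → Fin 4 → ℕ)) |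
        IsPermissibleData p.1 ∧ IsPermissibleData p.2 ∧
          ∃ rd, IsPositionData n rd (A, A, A + B) p.1 ∧ IsPositionData n rd (P, S, T) p.2}) := by
  refine nonempty_equiv_of_rel (fun d p => RSKRelated d.1 p.1.1 p.1.2) ?_ ?_ ?_ ?_
  · rintro ⟨d, hd⟩
    obtain ⟨d₁, d₂, h, hp⟩ := exists_rskRelated_right hn hT hd
    exact ⟨⟨(d₁, d₂), hp⟩, h⟩
  · rintro ⟨⟨d₁, d₂⟩, h₁, h₂, rd, hd₁, hd₂⟩
    obtain ⟨d, h, hd⟩ := exists_rskRelated_left hn hT h₁ h₂ hd₁ hd₂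
    exact ⟨⟨d, hd⟩, h⟩
  · rintro ⟨d, hd⟩ ⟨⟨d₁, d₂⟩, h₁, h₂, rd, hd₁, hd₂⟩ ⟨⟨d₁', d₂'⟩, h₁', h₂', rd', hd₁', hd₂'⟩ h h'
    obtain ⟨e₁, e₂⟩ := RSKRelated.right_unique h h' h₁ h₂ hd₁ hd₂ h₁' h₂' hd₁' hd₂'
    exact Subtype.ext (Prod.ext e₁ e₂)
  · rintro ⟨d, hd⟩ ⟨d', hd'⟩ ⟨⟨d₁, d₂⟩, _⟩ h h'
    exact Subtype.ext (RSKRelated.left_unique h h' hd hd')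

end Correspondence

/-! ### From positions to orbits, and the union over classes. -/

section PairOrbits

variable {R : Type*} [CommRing R] {n : ℕ}

/-- The pairs of flags in the position described by `d = (t, c)`. -/
def positionOrbit (π : R) (d : ℕ × (Fin 4 → Fin 4 → ℕ)) : Set (TwoFlag R n × TwoFlag R n) :=
  {p | PairPosition π d.1 d.2 p.1.top p.1.bot p.2.top p.2.bot}

theorem orbit_eq_positionOrbit {π : R} {d : ℕ × (Fin 4 → Fin 4 → ℕ)}
    {p : TwoFlag R n × TwoFlag R n} (hp : p ∈ positionOrbit π d) :
    MulAction.orbit (Matrix.GeneralLinearGroup (Fin n) R) p = positionOrbit π d := by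
  ext p'
  rw [mem_orbit_iff]
  constructor
  · rintro ⟨φ, rfl⟩
    exact PairPosition.map hp φ
  · intro hp'
    obtain ⟨φ, ⟨h1, h2⟩, h3, h4⟩ := PairPosition.exists_equiv hp hp'
    exact ⟨φ, Prod.ext (TwoFlag.ext h1.symm h2.symm) (TwoFlag.ext h3.symm h4.symm)⟩

attribute [local instance] Ideal.Quotient.field

variable {π : R} [(Ideal.span {π}).IsMaximal] {A B : ℕ}

/-- The dimensions of the flags of a given class. -/
noncomputable def paramDims (q : (Fin n → R) →ₗ[R] (Fin n → R ⧸ Ideal.span {π}))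
    (j : (Fin n → R ⧸ Ideal.span {π}) →ₗ[R] (Fin n → R)) (η : ParamSet π n A B) : ℕ × ℕ × ℕ :=
  flagDims (R ⧸ Ideal.span {π}) q j η.out.1

variable {q : (Fin n → R) →ₗ[R] (Fin n → R ⧸ Ideal.span {π})}
  {j : (Fin n → R ⧸ Ideal.span {π}) →ₗ[R] (Fin n → R)}

namespace IsReduction

variable (h : IsReduction (R ⧸ Ideal.span {π}) π q j)
include h

theorem isPositionData_of_mem {d : ℕ × (Fin 4 → Fin 4 → ℕ)} {p : TwoFlag R n × TwoFlag R n}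
    (hp : p ∈ positionOrbit π d) :
    IsPositionData n (flagDims (R ⧸ Ideal.span {π}) q j p.1)
      (flagDims (R ⧸ Ideal.span {π}) q j p.2) d := by
  refine ⟨?_, (h.flagDims_row hp).symm, (h.flagDims_col hp).symm⟩
  rw [← h.finrank_eq_of_pairPosition hp]
  simp

theorem exists_mem_positionOrbit {d : ℕ × (Fin 4 → Fin 4 → ℕ)} {rd cd : ℕ × ℕ × ℕ}
    (hd : IsPositionData n rd cd d) : ∃ y x : TwoFlag R n, (y, x) ∈ positionOrbit π d ∧
      (IsPreflag π y.top y.bot ∧ flagDims (R ⧸ Ideal.span {π}) q j y = rd) ∧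
      IsPreflag π x.top x.bot ∧ flagDims (R ⧸ Ideal.span {π}) q j x = cd := by
  obtain ⟨y₂, y₁, x₂, x₁, hp⟩ := exists_of_pairPosition π (Pi.basisFun R (Fin n)) hd.1
  obtain ⟨b, hby, hbx⟩ := id hp
  have hpy := h.isPreflag_of_flagAdapted hby
  have hpx := h.isPreflag_of_flagAdapted hbx
  have hp' : (⟨⟨y₂, y₁, hpy.le⟩, ⟨x₂, x₁, hpx.le⟩⟩ : TwoFlag R n × TwoFlag R n) ∈
    positionOrbit π d := hp
  have := h.isPositionData_of_mem hp'
  exact ⟨_, _, hp', ⟨hpy, this.2.1.symm.trans hd.2.1⟩, hpx, this.2.2.symm.trans hd.2.2⟩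

/-- Data with consistent marginals are realised by some pair, so the sets compared are nonempty and
uniqueness of the normal form applies. Without this restriction, data of the wrong total size would
all give the empty set. -/
theorem positionOrbit_injOn (rd cd : ℕ × ℕ × ℕ) : Set.InjOn
    (positionOrbit (n := n) π) {d | IsPositionData n rd cd d} := by
  intro d hd d' hd' hdd'
  obtain ⟨y, x, hp, -⟩ := h.exists_mem_positionOrbit hd
  obtain ⟨h1, h2⟩ := h.pairPosition_unique hp (hdd' ▸ hp : (y, x) ∈ positionOrbit π d')
  exact Prod.ext h1 h2

variable [Finite R] (h₀ : IsSquareZeroUniformizer π) (hn : A + B ≤ n)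
  {y₀ : Submodule R (Fin n → R)} (hy₀ : HasType π y₀ A B)
include h₀ hn hy₀

theorem mk_eq_iff (y x : ParamFlag π n A B) : (⟦y⟧ : ParamSet π n A B) = ⟦x⟧ ↔
    flagDims (R ⧸ Ideal.span {π}) q j y.1 = flagDims (R ⧸ Ideal.span {π}) q j x.1 := by
  rw [Quotient.eq]
  exact h.flagEquiv_iff ((h.isParamFlag_iff h₀ hn hy₀ _).1 y.2).1
    ((h.isParamFlag_iff h₀ hn hy₀ _).1 x.2).1

theorem paramDims_mk (x : ParamFlag π n A B) :
    paramDims q j (⟦x⟧ : ParamSet π n A B) = flagDims (R ⧸ Ideal.span {π}) q j x.1 :=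
  (h.mk_eq_iff h₀ hn hy₀ _ _).1 (Quotient.out_eq _)

theorem paramDims_injective : Function.Injective
    (paramDims q j : ParamSet π n A B → ℕ × ℕ × ℕ) := by
  intro η ξ hηξ
  rw [← Quotient.out_eq η, ← Quotient.out_eq ξ, h.mk_eq_iff h₀ hn hy₀]
  exact hηξ

/-- Membership in `𝓢_λ` depends only on the dimensions and on being a preflag, so a class consists
of all preflags with its dimensions. -/
theorem mem_Y_iff (η : ParamSet π n A B) (y : TwoFlag R n) : y ∈ Y η ↔
    IsPreflag π y.top y.bot ∧ flagDims (R ⧸ Ideal.span {π}) q j y = paramDims q j η := by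
  constructor
  · rintro ⟨hy, rfl⟩
    exact ⟨((h.isParamFlag_iff h₀ hn hy₀ y).1 hy).1, (h.paramDims_mk h₀ hn hy₀ ⟨y, hy⟩).symm⟩
  · rintro ⟨hy, hd⟩
    have hy' : IsParamFlag π A B y := by
      have := ((h.isParamFlag_iff h₀ hn hy₀ _).1 η.out.2).2
      refine (h.isParamFlag_iff h₀ hn hy₀ y).2 ⟨hy, ?_⟩
      rw [hd]
      exact this
    refine ⟨hy', h.paramDims_injective h₀ hn hy₀ ?_⟩
    rw [h.paramDims_mk h₀ hn hy₀, hd]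

theorem pairOrbits_eq_image (η ξ : ParamSet π n A B) : pairOrbits η ξ =
    positionOrbit π '' {d | IsPositionData n (paramDims q j η) (paramDims q j ξ) d} := by
  ext Ω
  constructor
  · rintro ⟨y, hy, x, hx, rfl⟩
    rw [h.mem_Y_iff h₀ hn hy₀] at hy hx
    obtain ⟨t, c, hp⟩ := h.exists_pairPosition hy.1 hx.1
    have hp' : (y, x) ∈ positionOrbit π (t, c) := hp
    have := h.isPositionData_of_mem hp'
    rw [hy.2, hx.2] at this
    exact ⟨_, this, (orbit_eq_positionOrbit hp').symm⟩
  · rintro ⟨d, hd, rfl⟩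
    obtain ⟨y, x, hp, hy, hx⟩ := h.exists_mem_positionOrbit hd
    exact ⟨y, (h.mem_Y_iff h₀ hn hy₀ _ _).2 hy, x, (h.mem_Y_iff h₀ hn hy₀ _ _).2 hx,
      (orbit_eq_positionOrbit hp).symm⟩

theorem permissibleOrbits_eq_image (η ξ : ParamSet π n A B) : permissibleOrbits η ξ =
    positionOrbit π '' {d | IsPositionData n (paramDims q j η) (paramDims q j ξ) d ∧
      IsPermissibleData d} := by
  ext Ω
  constructor
  · rintro ⟨y, hy, x, hx, hyx, rfl⟩
    rw [h.mem_Y_iff h₀ hn hy₀] at hy hx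
    obtain ⟨t, c, hp⟩ := h.exists_pairPosition hy.1 hx.1
    have hp' : (y, x) ∈ positionOrbit π (t, c) := hp
    have := h.isPositionData_of_mem hp'
    rw [hy.2, hx.2] at this
    exact ⟨_, ⟨this, (h.embedsPermissibly_iff hp).1 hyx⟩, (orbit_eq_positionOrbit hp').symm⟩
  · rintro ⟨d, ⟨hd, hperm⟩, rfl⟩
    obtain ⟨y, x, hp, hy, hx⟩ := h.exists_mem_positionOrbit hd
    exact ⟨y, (h.mem_Y_iff h₀ hn hy₀ _ _).2 hy, x, (h.mem_Y_iff h₀ hn hy₀ _ _).2 hx,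
      (h.embedsPermissibly_iff hp).2 hperm, (orbit_eq_positionOrbit hp).symm⟩

theorem nonempty_pairOrbits_equiv (η ξ : ParamSet π n A B) : Nonempty (pairOrbits η ξ ≃
    {d | IsPositionData n (paramDims q j η) (paramDims q j ξ) d}) := by
  rw [h.pairOrbits_eq_image h₀ hn hy₀]
  exact ⟨(Equiv.Set.imageOfInjOn _ _ (h.positionOrbit_injOn _ _)).symm⟩

theorem nonempty_permissibleOrbits_equiv (η ξ : ParamSet π n A B) :
    Nonempty (permissibleOrbits η ξ ≃
      {d | IsPositionData n (paramDims q j η) (paramDims q j ξ) d ∧ IsPermissibleData d}) := by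
  rw [h.permissibleOrbits_eq_image h₀ hn hy₀]
  exact ⟨(Equiv.Set.imageOfInjOn _ _ ((h.positionOrbit_injOn _ _).mono fun d hd => hd.1)).symm⟩

theorem paramLE_of_isPermissibleData {η ξ : ParamSet π n A B} {d : ℕ × (Fin 4 → Fin 4 → ℕ)}
    (hd : IsPositionData n (paramDims q j η) (paramDims q j ξ) d) (hperm : IsPermissibleData d) :
    ParamLE η ξ := by
  obtain ⟨y, x, hp, hy, hx⟩ := h.exists_mem_positionOrbit hd
  obtain ⟨htop, hbot, -⟩ := (h.embedsPermissibly_iff hp).2 hperm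
  obtain ⟨hy', hyη⟩ := (h.mem_Y_iff h₀ hn hy₀ _ _).2 hy
  obtain ⟨hx', hxξ⟩ := (h.mem_Y_iff h₀ hn hy₀ _ _).2 hx
  exact ⟨_, _, hyη, hxξ, inclusion htop, inclusion hbot, inclusion_injective _,
    inclusion_injective _, fun v => rfl⟩

/-- The dimensions of a flag that embeds permissibly into `ι(λ)` are those of a class. -/
theorem exists_paramDims_eq {rd : ℕ × ℕ × ℕ} {d : ℕ × (Fin 4 → Fin 4 → ℕ)}
    (hd : IsPositionData n rd (A, A, A + B) d) (hperm : IsPermissibleData d) :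
    ∃ η : ParamSet π n A B, paramDims q j η = rd := by
  obtain ⟨y, x, -, ⟨hy, hyd⟩, -⟩ := h.exists_mem_positionOrbit hd
  have hy' : IsParamFlag π A B y := by
    refine (h.isParamFlag_iff h₀ hn hy₀ y).2 ⟨hy, ?_⟩
    rw [hyd]
    obtain ⟨P, S, T⟩ := rd
    obtain ⟨t, c⟩ := d
    rw [isPositionData_iff] at hd
    obtain ⟨rfl, h30, h31, h32, ⟨h10, -, -, -⟩, h20, h21, h22, h23⟩ := hperm
    simp only at h30 h31 h32 h10 h20 h21 h22 h23 ⊢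
    omega
  exact ⟨⟦⟨y, hy'⟩⟧, (h.paramDims_mk h₀ hn hy₀ _).trans hyd⟩

/-- The class `η` is recovered from the common row dimensions `rd`. Permissibility into `ι(λ)` shows
that `rd` comes from a class, and permissibility into `ξ` gives `η ≤ ξ`, so no restriction on `rd`
remains. -/
theorem nonempty_sigma_equiv {lam ξ : ParamSet π n A B}
    (hlam : paramDims q j lam = (A, A, A + B)) :
    Nonempty ((Σ η : {η : ParamSet π n A B // ParamLE η ξ},
        permissibleOrbits η.1 lam × permissibleOrbits η.1 ξ) ≃
      {p : (ℕ × (Fin 4 → Fin 4 → ℕ)) × (ℕ × (Fin 4 → Fin 4 → ℕ)) |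
        IsPermissibleData p.1 ∧ IsPermissibleData p.2 ∧ ∃ rd,
          IsPositionData n rd (paramDims q j lam) p.1 ∧
            IsPositionData n rd (paramDims q j ξ) p.2}) := by
  have e (η ξ : ParamSet π n A B) := (h.nonempty_permissibleOrbits_equiv h₀ hn hy₀ η ξ).some
  refine ⟨(Equiv.sigmaCongrRight fun η : {η // ParamLE η ξ} => (e η.1 lam).prodCongr (e η.1 ξ)).trans ?_⟩
  refine Equiv.ofBijective (fun s => ⟨(s.2.1.1, s.2.2.1), s.2.1.2.2, s.2.2.2.2,
    paramDims q j s.1.1, s.2.1.2.1, s.2.2.2.1⟩) ⟨?_, ?_⟩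
  · rintro ⟨⟨η, hη⟩, ⟨d₁, hd₁⟩, d₂, hd₂⟩ ⟨⟨η', hη'⟩, ⟨d₁', hd₁'⟩, d₂', hd₂'⟩ heq
    obtain ⟨rfl, rfl⟩ : d₁ = d₁' ∧ d₂ = d₂' := Prod.ext_iff.1 (congrArg Subtype.val heq)
    obtain rfl : η = η' :=
      h.paramDims_injective h₀ hn hy₀ (hd₁.1.2.1.symm.trans hd₁'.1.2.1)
    rfl
  · rintro ⟨⟨d₁, d₂⟩, h₁, h₂, rd, hd₁, hd₂⟩
    obtain ⟨η, rfl⟩ := h.exists_paramDims_eq h₀ hn hy₀ (hlam ▸ hd₁) h₁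
    exact ⟨⟨⟨η, h.paramLE_of_isPermissibleData h₀ hn hy₀ hd₂ h₂⟩, ⟨d₁, hd₁, h₁⟩,
      ⟨d₂, hd₂, h₂⟩⟩, rfl⟩

end IsReduction

/-- The correspondence over a quotient of length two of a discrete valuation ring. -/
theorem IsSquareZeroUniformizer.nonempty_pairOrbits_equiv_sigma [Finite R]
    (h₀ : IsSquareZeroUniformizer π) (hn : 2 * (A + B) ≤ n) (x : ParamFlag π n A B)
    (hx₂ : HasType π x.1.top A B) (hx₁ : x.1.bot = piMul π x.1.top) (ξ : ParamSet π n A B) :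
    Nonempty (pairOrbits (⟦x⟧ : ParamSet π n A B) ξ ≃
      Σ η : {η : ParamSet π n A B // ParamLE η ξ},
        permissibleOrbits η.1 (⟦x⟧ : ParamSet π n A B) × permissibleOrbits η.1 ξ) := by
  have h := h₀.isReduction n
  have hn' : A + B ≤ n := by omega
  have hx : x.1 = iota π x.1.top := TwoFlag.ext rfl hx₁
  have hlam := (h.paramDims_mk h₀ hn' hx₂ x).trans
    ((congrArg _ hx).trans (h.flagDims_iota h₀ hx₂))
  have hT := ((h.isParamFlag_iff h₀ hn' hx₂ _).1 ξ.out.2).2.2.2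
  obtain ⟨e₁⟩ := h.nonempty_pairOrbits_equiv h₀ hn' hx₂ ⟦x⟧ ξ
  obtain ⟨e₂⟩ := nonempty_positionData_equiv hn hT
  obtain ⟨e₃⟩ := h.nonempty_sigma_equiv h₀ hn' hx₂ (ξ := ξ) hlam
  rw [hlam] at e₁ e₃
  exact ⟨e₁.trans (e₂.trans e₃.symm)⟩

end PairOrbits

/-! ### The quotient by the square of the maximal ideal of a discrete valuation ring. -/

section DiscreteValuationRing

variable {𝔬 : Type*} [CommRing 𝔬] [IsDomain 𝔬] [IsDiscreteValuationRing 𝔬]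

theorem isSquareZeroUniformizer_mk {ϖ : 𝔬} (hϖ : Irreducible ϖ) : IsSquareZeroUniformizer
    (Ideal.Quotient.mk (IsLocalRing.maximalIdeal 𝔬 ^ 2) ϖ) := by
  have hm : IsLocalRing.maximalIdeal 𝔬 = Ideal.span {ϖ} := hϖ.maximalIdeal_eq
  have hmem : ∀ r, r ∈ IsLocalRing.maximalIdeal 𝔬 ^ 2 ↔ ϖ * ϖ ∣ r := fun r => by
    rw [hm, Ideal.span_singleton_pow, Ideal.mem_span_singleton, pow_two]
  refine ⟨?_, fun r => ?_, ?_⟩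
  · rw [← map_mul, Ideal.Quotient.eq_zero_iff_mem, hmem]
  · obtain ⟨r, rfl⟩ := Ideal.Quotient.mk_surjective r
    rw [← map_mul, Ideal.Quotient.eq_zero_iff_mem, hmem]
    intro hr
    exact map_dvd _ ((mul_dvd_mul_iff_left hϖ.ne_zero).1 hr)
  · have := Ideal.IsMaximal.map_of_surjective_of_ker_le
      (f := Ideal.Quotient.mk (IsLocalRing.maximalIdeal 𝔬 ^ 2)) Ideal.Quotient.mk_surjective
      (m := IsLocalRing.maximalIdeal 𝔬) (by rw [Ideal.mk_ker]; exact Ideal.pow_le_self two_ne_zero)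
    rwa [← Set.image_singleton, ← Ideal.map_span, ← hm]

theorem finite_quotient_maximalIdeal_sq [Finite (IsLocalRing.ResidueField 𝔬)] :
    Finite (𝔬 ⧸ IsLocalRing.maximalIdeal 𝔬 ^ 2) := by
  have : Finite (𝔬 ⧸ IsLocalRing.maximalIdeal 𝔬) := ‹Finite (IsLocalRing.ResidueField 𝔬)›
  exact Ideal.finite_quotient_pow (IsNoetherian.noetherian _) 2

end DiscreteValuationRing

end RSKModules

theorem proposition4p2 {𝔬 : Type*} [CommRing 𝔬] [IsDomain 𝔬] [IsDiscreteValuationRing 𝔬]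
    [IsAdicComplete (IsLocalRing.maximalIdeal 𝔬) 𝔬] [Finite (IsLocalRing.ResidueField 𝔬)]
    (ϖ : 𝔬) (hϖ : Irreducible ϖ)
    (π : 𝔬 ⧸ IsLocalRing.maximalIdeal 𝔬 ^ 2)
    (hπ : π = Ideal.Quotient.mk (IsLocalRing.maximalIdeal 𝔬 ^ 2) ϖ)
    (n A B : ℕ) (hn : 2 * (A + B) ≤ n) (hA : 2 * A ≤ A + B)
    (x : RSKModules.ParamFlag π n A B)
    (hx₂ : RSKModules.HasType π x.1.top A B)
    (hx₁ : x.1.bot = RSKModules.piMul π x.1.top)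
    (ξ : RSKModules.ParamSet π n A B) :
    Nonempty (RSKModules.pairOrbits (⟦x⟧ : RSKModules.ParamSet π n A B) ξ ≃
      Σ η : {η : RSKModules.ParamSet π n A B // RSKModules.ParamLE η ξ},
        RSKModules.permissibleOrbits η.1 (⟦x⟧ : RSKModules.ParamSet π n A B) ×
          RSKModules.permissibleOrbits η.1 ξ) := by
  subst hπ
  have h₀ := RSKModules.isSquareZeroUniformizer_mk hϖ
  have := h₀.isMaximal
  have := RSKModules.finite_quotient_maximalIdeal_sq (𝔬 := 𝔬)
  exact h₀.nonempty_pairOrbits_equiv_sigma hn x hx₂ hx₁ ξ
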